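/- Let $\ell\in\frac12\mathbb{N}$ ($\ell=0$ allowed). Matrices in $M_{2\ell+1}(\mathbb{C})$ have rows and columns indexed by $0,1,\dots,2\ell$; $E_{ij}$ denotes the matrix unit, with $E_{ij}=0$ if $i$ or $j$ is outside $\{0,\dots,2\ell\}$; $(a)_k=a(a+1)\cdots(a+k-1)$; and $U_n$ is the Chebyshev polynomial of the second kind. For $x\in[-1,1]$ let $W(x)=(W(x)_{n,m})_{n,m=0}^{2\ell}$ be the symmetric matrix with, for $n\ge m$, $$W(x)_{n,m}=\sqrt{1-x^2}\sum_{t=0}^m\alpha_t(m,n)\,U_{n+m-2t}(x),$$ $$\alpha_t(m,n)=\frac{2\ell+1}{n+1}\,\frac{(2\ell-m)!\,m!}{(2\ell)!}\,(-1)^{m-t}\,\frac{(n-2\ell)_{m-t}}{(n+2)_{m-t}}\,\frac{(2\ell+2-t)_t}{t!}.$$ For polynomials $P,Q$ with coefficients in $M_{2\ell+1}(\mathbb{C})$ put $\langle P,Q\rangle_W=\int_{-1}^1P(x)W(x)Q(x)^*\,dx$. A differential operator $T=\sum_i\frac{d^i}{dx^i}F_i(x)$ with matrix-valued polynomial coefficients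 acts on matrix-valued polynomials from the right: $PT=\sum_i\frac{d^iP}{dx^i}F_i$. It is symmetric with respect to $W$ if $\langle PT,Q\rangle_W=\langle P,QT\rangle_W$ for all matrix-valued polynomials $P,Q$. There is a unique sequence $(P_n)_{n\ge0}$ of monic matrix-valued orthogonal polynomials for $W$, i.e. $P_n$ has degree $n$ and leading coefficient $I$, and $\langle P_n,P_m\rangle_W=\delta_{nm}H_n$ with $H_n$ positive definite. Define the second-order operator $$\tilde D=(1-x^2)\frac{d^2}{dx^2}+\Bigl(\frac{d}{dx}\Bigr)(\tilde C-x\tilde U)-\tilde V,$$ $$\tilde C=\sum_{i=0}^{2\ell}(2\ell-i)E_{i,i+1}+\sum_{i=0}^{2\ell}iE_{i,i-1},\qquad \tilde U=(2\ell+3)I,\qquad \tilde V=-\sum_{i=0}^{2\ell}i(2\ell-i)E_{ii},$$ and, if $\ell>0$, the first-order operator $$\tilde E=\Bigl(\frac{d}{dx}\Bigr)(\tilde B_0+x\tilde B_1)+\tilde A,\qquad \tilde B_0=-\sum_{i=0}^{2\ell}\frac{2\ell-i}{4\ell}E_{i,i+1}+\sum_{i=0}^{2\ell}\frac{i}{4\ell}E_{i,i-1},$$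 $$\tilde B_1=\sum_{i=0}^{2\ell}\frac{\ell-i}{2\ell}E_{ii},\qquad \tilde A=\sum_{i=0}^{2\ell}\frac{(2\ell+2)(i-2\ell)}{-4\ell}E_{ii}.$$ Then for all $n\ge0$ $$P_n\tilde D=\Lambda_n(\tilde D)P_n,\qquad \Lambda_n(\tilde D)=\sum_{i=0}^{2\ell}\bigl(-n(n-1)-n(2\ell+3)+i(2\ell-i)\bigr)E_{ii},$$ and, if $\ell>0$, $$P_n\tilde E=\Lambda_n(\tilde E)P_n,\qquad \Lambda_n(\tilde E)=\sum_{i=0}^{2\ell}\Bigl(\frac{n(\ell-i)}{2\ell}-\frac{(2\ell+2)(i-2\ell)}{4\ell}\Bigr)E_{ii}.$$ The operator $\tilde D$ is symmetric with respect to $W$; if $\ell>0$, $\tilde E$ is symmetric with respect to $W$ as well, and $\tilde D$ and $\tilde E$ commute, i.e. $(Q\tilde D)\tilde E=(Q\tilde E)\tilde D$ for every matrix-valued polynomial $Q$. -/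

import Mathlib

open Polynomial
open scoped ComplexOrder

noncomputable section

namespace MVOP

/-! Throughout, `L : ℕ` stands for `2ℓ`, with `ℓ ∈ ½ℕ`. Matrices have size `2ℓ + 1`, with rows and
columns indexed by `0, …, 2ℓ`. -/

/-- The spin `ℓ = L / 2`. -/
def ell (L : ℕ) : ℂ := (L : ℂ) / 2

/-- `M_{2ℓ+1}(ℂ)`. -/
abbrev Mat (L : ℕ) : Type := Matrix (Fin (L + 1)) (Fin (L + 1)) ℂ

/-- Matrix-valued polynomials `P(x) = ∑ₖ xᵏ Pₖ` with `Pₖ ∈ M_{2ℓ+1}(ℂ)`; `x` is central. -/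
abbrev MatPoly (L : ℕ) : Type := (Mat L)[X]

/-- The matrix unit `E_{ij}`, which is zero if `i` or `j` is not in `{0, …, 2ℓ}`. -/
def matUnit (L : ℕ) (i j : ℤ) : Mat L :=
  Matrix.of fun a b => if ((a : ℕ) : ℤ) = i ∧ ((b : ℕ) : ℤ) = j then 1 else 0

/-- The value `P(x)` at a real point `x`. -/
def evalAt {L : ℕ} (P : MatPoly L) (x : ℝ) : Mat L :=
  P.eval (Matrix.scalar (Fin (L + 1)) (x : ℂ))

/-! ### The weight -/

/-- The Pochhammer symbol `(a)ₖ = a (a + 1) ⋯ (a + k - 1)`. -/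
def poch (a : ℝ) (k : ℕ) : ℝ := (ascPochhammer ℝ k).eval a

/-- The coefficients `α_t(m, n)`, for `0 ≤ t ≤ m ≤ n ≤ 2ℓ`. -/
def alpha (L t m n : ℕ) : ℝ :=
  ((L : ℝ) + 1) / ((n : ℝ) + 1)
    * (((L - m).factorial : ℝ) * (m.factorial : ℝ) / (L.factorial : ℝ))
    * (-1) ^ (m - t)
    * (poch ((n : ℝ) - L) (m - t) / poch ((n : ℝ) + 2) (m - t))
    * (poch ((L : ℝ) + 2 - t) t / (t.factorial : ℝ))

/-- The entry `W(x)_{n,m}` for `m ≤ n`. -/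
def weightEntry (L n m : ℕ) (x : ℝ) : ℝ :=
  √(1 - x ^ 2) *
    ∑ t ∈ Finset.range (m + 1),
      alpha L t m n * (Chebyshev.U ℝ ((n : ℤ) + m - 2 * t)).eval x

/-- The weight `W(x)`, with `W(x)_{n,m} = W(x)_{m,n}` for `n < m`. -/
def weight (L : ℕ) (x : ℝ) : Mat L :=
  Matrix.of fun n m =>
    if (m : ℕ) ≤ (n : ℕ) then (weightEntry L n m x : ℂ) else (weightEntry L m n x : ℂ)

/-- The matrix-valued inner product `⟨P, Q⟩_W = ∫_{-1}^1 P(x) W(x) Q(x)^* dx`, where the integral is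
taken entrywise. -/
def innerW {L : ℕ} (P Q : MatPoly L) : Mat L :=
  Matrix.of fun i j =>
    ∫ x in (-1 : ℝ)..1, (evalAt P x * weight L x * (evalAt Q x).conjTranspose) i j

/-- `P` is a sequence of monic matrix-valued orthogonal polynomials for `W`: `Pₙ` has degree `n` and
leading coefficient `I`, and `⟨Pₙ, Pₘ⟩_W = δ_{nm} Hₙ` with `Hₙ` positive definite. -/
def IsMonicOrthogonal (L : ℕ) (P : ℕ → MatPoly L) : Prop :=
  (∀ n, (P n).natDegree = n ∧ (P n).Monic) ∧
  (∀ n m, n ≠ m → innerW (P n) (P m) = 0) ∧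
  (∀ n, (innerW (P n) (P n)).PosDef)

/-! ### Matrix-valued differential operators, acting on the right -/

/-- The coefficients `F₀, …, F_s` of a differential operator `∑ᵢ (dⁱ/dxⁱ) Fᵢ(x)` of order at most
`s` with polynomial coefficients. -/
abbrev DiffOp (L s : ℕ) : Type := Fin (s + 1) → MatPoly L

/-- The right action `P D = ∑ᵢ (dⁱP/dxⁱ) Fᵢ`. -/
def DiffOp.act {L s : ℕ} (D : DiffOp L s) (P : MatPoly L) : MatPoly L :=
  ∑ i : Fin (s + 1), (derivative^[(i : ℕ)] P) * D i

/-- `D` is symmetric with respect to `W`. -/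
def DiffOp.IsSymmetric {L s : ℕ} (D : DiffOp L s) : Prop :=
  ∀ P Q : MatPoly L, innerW (D.act P) Q = innerW P (D.act Q)

def matC (L : ℕ) : Mat L :=
  ∑ i ∈ Finset.range (L + 1), (2 * ell L - i) • matUnit L i (i + 1)
    + ∑ i ∈ Finset.range (L + 1), (i : ℂ) • matUnit L i (i - 1)

def matU (L : ℕ) : Mat L := (2 * ell L + 3) • (1 : Mat L)

def matV (L : ℕ) : Mat L :=
  -∑ i ∈ Finset.range (L + 1), ((i : ℂ) * (2 * ell L - i)) • matUnit L i i

/-- `D̃ = (1 - x²) d²/dx² + (d/dx)(C̃ - x Ũ) - Ṽ`. -/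
def opD (L : ℕ) : DiffOp L 2 :=
  ![-C (matV L), C (matC L) - X * C (matU L), 1 - X ^ 2]

/-- The eigenvalue matrix `Λₙ(D̃)`. -/
def eigD (L n : ℕ) : Mat L :=
  ∑ i ∈ Finset.range (L + 1),
    (-(n : ℂ) * (n - 1) - n * (2 * ell L + 3) + i * (2 * ell L - i)) • matUnit L i i

def matB0 (L : ℕ) : Mat L :=
  -∑ i ∈ Finset.range (L + 1), ((2 * ell L - i) / (4 * ell L)) • matUnit L i (i + 1)
    + ∑ i ∈ Finset.range (L + 1), ((i : ℂ) / (4 * ell L)) • matUnit L i (i - 1)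

def matB1 (L : ℕ) : Mat L :=
  ∑ i ∈ Finset.range (L + 1), ((ell L - i) / (2 * ell L)) • matUnit L i i

def matA (L : ℕ) : Mat L :=
  ∑ i ∈ Finset.range (L + 1),
    ((2 * ell L + 2) * (i - 2 * ell L) / (-4 * ell L)) • matUnit L i i

/-- `Ẽ = (d/dx)(B̃₀ + x B̃₁) + Ã`, for `ℓ > 0`. -/
def opE (L : ℕ) : DiffOp L 1 :=
  ![C (matA L), C (matB0 L) + X * C (matB1 L)]

/-- The eigenvalue matrix `Λₙ(Ẽ)`, for `ℓ > 0`. -/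
def eigE (L n : ℕ) : Mat L :=
  ∑ i ∈ Finset.range (L + 1),
    ((n : ℂ) * (ell L - i) / (2 * ell L)
      - (2 * ell L + 2) * (i - 2 * ell L) / (4 * ell L)) • matUnit L i i

end MVOP

end

noncomputable section

namespace MVOP

/-! ### Contiguous relations for the coefficients of the weight -/

/-! Symmetry rests on four first-order identities for the entries of `W`. With x = cos θ, √(1-x²)
U_k(x) = sin((k+1)θ), so each entry is a sine polynomial (`wsin`). Its coefficients are
hypergeometric, hence linked to those of neighbouring entries by contiguous relations. Comparing
Fourier coefficients yields a lowering and a raising formula for (1-x²)W' + xW (`wderiv_lower`,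
`wderiv_raise`), and two formulas for derivatives of antisymmetric combinations of neighbours
(`wderiv_lower_sub`, `wderiv_raise_sub`). Adding lowering and raising gives the Pearson equations of
D̃; subtracting gives those of Ẽ. Integration by parts then proves symmetry
(`isSymmetric_of_pearson`), without boundary terms because W(±1) = 0.

Eliminating W' between lowering and raising leaves a recurrence that determines `W` from its first
column. The Gram matrix of the polynomials (z+y)ⁿ(1+zy)^{L-n}, z = e^{iθ}, for the form ⟨yⁱ, yʲ⟩ =
δᵢⱼ binom(L,j)⁻², satisfies the same recurrence and, up to the factor √(1-x²), has the same first
column (`wval_eq_gram`). These polynomials are independent when z² ≠ 1, so `W` is positive definite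
on (-1,1).

Thus ⟨P,P⟩ = 0 only for P = 0, and Gram–Schmidt gives existence and uniqueness. A symmetric operator
that acts on top coefficients by right multiplication by Λₙ has every Pₙ as eigenfunction
(`IsMonicOrthogonal.act_eq`). The operators commute since their eigenvalue matrices are diagonal and
the Pₙ generate all matrix polynomials over left matrix coefficients. -/

theorem poch_zero (a : ℝ) : poch a 0 = 1 := by simp [poch]

theorem poch_succ (a : ℝ) (k : ℕ) : poch a (k + 1) = poch a k * (a + k) := by
  simp [poch, ascPochhammer_succ_eval]

theorem poch_succ_left (a : ℝ) (k : ℕ) : poch a (k + 1) = a * poch (a + 1) k := by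
  simp [poch, ascPochhammer_succ_left, eval_comp]

theorem poch_pos {a : ℝ} (ha : 0 < a) (k : ℕ) : 0 < poch a k := ascPochhammer_pos k a ha

/-- The coefficients of the weight, symmetric in `n` and `m` and extended by zero. -/
def wcoeff (L n m t : ℕ) : ℝ :=
  if t ≤ min n m then alpha L t (min n m) (max n m) else 0

theorem wcoeff_comm (L n m t : ℕ) : wcoeff L n m t = wcoeff L m n t := by
  simp only [wcoeff, min_comm, max_comm]

theorem wcoeff_of_le {L n m t : ℕ} (h : m ≤ n) (ht : t ≤ m) :
    wcoeff L n m t = alpha L t m n := by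
  simp [wcoeff, h, ht]

theorem wcoeff_of_lt_right {L n m t : ℕ} (ht : m < t) : wcoeff L n m t = 0 := by
  rw [wcoeff, if_neg]
  exact fun h => absurd (h.trans (min_le_right _ _)) (by omega)

theorem wcoeff_of_lt_left {L n m t : ℕ} (ht : n < t) : wcoeff L n m t = 0 := by
  rw [wcoeff_comm, wcoeff_of_lt_right ht]

theorem alpha_eq {L t m n : ℕ} (k d : ℕ) (hm : m = t + k) (hL : L = m + d) :
    alpha L t m n = ((L : ℝ) + 1) / (n + 1) * (d.factorial * m.factorial / L.factorial) * (-1) ^ k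
      * (poch (n - L) k / poch (n + 2) k) * (poch (L + 2 - t) t / t.factorial) := by
  have h1 : m - t = k := by omega
  have h2 : L - m = d := by omega
  rw [alpha, h1, h2]

theorem poch_ratio_succ (L t : ℕ) :
    poch ((L : ℝ) + 2 - (t + 1 : ℕ)) (t + 1) / ((t + 1).factorial : ℝ)
      = (L + 1 - t) / (t + 1) * (poch (L + 2 - t) t / t.factorial) := by
  have h : (L : ℝ) + 2 - (t + 1 : ℕ) + 1 = L + 2 - t := by push_cast; ring
  rw [poch_succ_left, h, Nat.factorial_succ]
  have := Nat.factorial_ne_zero t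
  push_cast
  field_simp
  ring

/-- The four neighbours share a factor `c`, built from Pochhammer symbols of length `m - t - 1`. A
common factor is used instead of quotients because the coefficients themselves can vanish, for
instance when `n = L`. -/
theorem alpha_lower {L m n t : ℕ} (ht : t < m) (hmn : m ≤ n) (hL : m ≤ L) : ∃ c : ℝ,
    alpha L t m n = -c * m * (n - L + (m - t - 1)) / ((n + 1) * (n + 2 + (m - t - 1))) ∧
    alpha L (t + 1) m n = c * m * (L + 1 - t) / ((t + 1) * (n + 1)) ∧
    alpha L t m (n - 1) = -c * m * (n - 1 - L) / (n * (n + 1)) ∧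
    alpha L t (m - 1) n = c * (L - m + 1) / (n + 1) := by
  obtain ⟨k, rfl⟩ : ∃ k, m = t + 1 + k := ⟨m - t - 1, by omega⟩
  obtain ⟨d, hd⟩ : ∃ d, L = t + 1 + k + d := ⟨L - (t + 1 + k), by omega⟩
  obtain ⟨N, rfl⟩ : ∃ N, n = N + 1 := ⟨n - 1, by omega⟩
  have hk : ((t + 1 + k : ℕ) : ℝ) - t - 1 = k := by push_cast; ring
  rw [hk]
  refine ⟨(L + 1) * d.factorial * (t + k).factorial / L.factorial * (-1) ^ k *
    (poch ((N + 1 : ℕ) - L) k / poch ((N + 1 : ℕ) + 2) k) * (poch (L + 2 - t) t / t.factorial),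
    ?_, ?_, ?_, ?_⟩
  · have hq := (poch_pos (show (0 : ℝ) < (N + 1 : ℕ) + 2 by positivity) k).ne'
    rw [alpha_eq (k + 1) d (by omega) hd, poch_succ, poch_succ,
      show t + 1 + k = t + k + 1 by ring, Nat.factorial_succ]
    push_cast at hq ⊢
    field_simp
    ring
  · rw [alpha_eq k d (by omega) hd, poch_ratio_succ, show t + 1 + k = t + k + 1 by ring,
      Nat.factorial_succ]
    push_cast
    field_simp
  · have hq := (poch_pos (show (0 : ℝ) < (N + 1 : ℕ) + 2 by positivity) k).ne'
    rw [Nat.add_sub_cancel, alpha_eq (k + 1) d (by omega) hd, poch_succ_left, poch_succ_left,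
      show t + 1 + k = t + k + 1 by ring, Nat.factorial_succ,
      show (N : ℝ) - L + 1 = (N + 1 : ℕ) - L by push_cast; ring,
      show (N : ℝ) + 2 + 1 = (N + 1 : ℕ) + 2 by push_cast; ring]
    push_cast at hq ⊢
    field_simp
    ring
  · have hc : (L : ℝ) - (t + 1 + k : ℕ) + 1 = d + 1 := by rw [hd]; push_cast; ring
    rw [hc, alpha_eq k (d + 1) (by omega) (by omega), Nat.factorial_succ d,
      show t + 1 + k - 1 = t + k by omega]
    push_cast
    field_simp

/-- The upward counterpart of `alpha_lower`. The factors `L - n` and `L - m` are those of the matrix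
C̃; they also clear denominators that vanish at the edge of the index range. -/
theorem alpha_raise {L m n t : ℕ} (ht : t ≤ m) (hmn : m ≤ n) (hL : m ≤ L) : ∃ c : ℝ,
    alpha L t m n = c / (n + 1) ∧
    (0 < t → alpha L (t - 1) m n
      = -c * (n - L + (m - t)) * t / ((n + 1) * (n + 2 + (m - t)) * (L + 2 - t))) ∧
    (L - n) * alpha L t m (n + 1) = -c * (n - L + (m - t)) / (n + 2 + (m - t)) ∧
    (m < L → (L - m) * alpha L t (m + 1) n
      = -c * (m + 1) * (n - L + (m - t)) / ((n + 1) * (n + 2 + (m - t)))) := by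
  obtain ⟨k, rfl⟩ : ∃ k, m = t + k := ⟨m - t, by omega⟩
  obtain ⟨d, hd⟩ : ∃ d, L = t + k + d := ⟨L - (t + k), by omega⟩
  have hq := (poch_pos (show (0 : ℝ) < (n : ℝ) + 2 by positivity) k).ne'
  have hk : ((t + k : ℕ) : ℝ) - t = k := by push_cast; ring
  rw [hk]
  refine ⟨(L + 1) * d.factorial * (t + k).factorial / L.factorial * (-1) ^ k *
    (poch (n - L) k / poch (n + 2) k) * (poch (L + 2 - t) t / t.factorial),
    ?_, fun h => ?_, ?_, fun h => ?_⟩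
  · rw [alpha_eq k d (by omega) hd]
    field_simp
  · obtain ⟨s, rfl⟩ : ∃ s, t = s + 1 := ⟨t - 1, by omega⟩
    have h0 : (L : ℝ) + 1 - s ≠ 0 := by
      have : (s : ℝ) ≤ L := by exact_mod_cast (by omega : s ≤ L)
      linarith
    rw [poch_ratio_succ, Nat.add_sub_cancel, alpha_eq (k + 1) d (by omega) hd, poch_succ, poch_succ]
    have h1 : (L : ℝ) + 2 - (s + 1 : ℕ) = L + 1 - s := by push_cast; ring
    rw [h1]
    push_cast
    field_simp
    ring
  -- Expanding (a)_{k+1} from either end gives a·(a+1)_k = (a)_k·(a+k), which moves `n` to `n + 1`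
  -- without division by `n - L`.
  · have e1 : ((L : ℝ) - n) * poch ((n + 1 : ℕ) - L) k = -(poch (n - L) k * (n - L + k)) := by
      rw [← poch_succ, poch_succ_left]; push_cast; ring_nf
    have e2 : ((n : ℝ) + 2) * poch ((n + 1 : ℕ) + 2) k = poch (n + 2) k * (n + 2 + k) := by
      rw [← poch_succ, poch_succ_left]; push_cast; ring_nf
    have hq' := (poch_pos (show (0 : ℝ) < ((n + 1 : ℕ) : ℝ) + 2 by positivity) k).ne'
    have e3 : ((L : ℝ) - n) * (poch ((n + 1 : ℕ) - L) k / poch ((n + 1 : ℕ) + 2) k)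
        = -(n + 2) * (poch (n - L) k * (n - L + k)) / (poch (n + 2) k * (n + 2 + k)) := by
      rw [← e2, mul_div_assoc', e1]
      field_simp
    rw [alpha_eq k d (by omega) hd]
    calc _ = ((L : ℝ) + 1) / ((n + 1 : ℕ) + 1) * (d.factorial * (t + k).factorial / L.factorial)
          * (-1) ^ k * (((L : ℝ) - n) * (poch ((n + 1 : ℕ) - L) k / poch ((n + 1 : ℕ) + 2) k))
          * (poch (L + 2 - t) t / t.factorial) := by ring
      _ = _ := by
        rw [e3]
        push_cast
        have : (n : ℝ) + 2 + k ≠ 0 := by positivity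
        field_simp
        ring
  · obtain ⟨e, rfl⟩ : ∃ e, d = e + 1 := ⟨d - 1, by omega⟩
    have hc : (L : ℝ) - (t + k : ℕ) = e + 1 := by rw [hd]; push_cast; ring
    rw [hc, alpha_eq (k + 1) e (by omega) (by omega), poch_succ, poch_succ, Nat.factorial_succ e,
      Nat.factorial_succ (t + k)]
    push_cast
    field_simp
    ring

/-- The predecessor shift of a sequence, with value `0` at `0`. -/
def shiftRight (f : ℕ → ℝ) : ℕ → ℝ
  | 0 => 0
  | t + 1 => f t

theorem shiftRight_of_pos (f : ℕ → ℝ) {t : ℕ} (h : 0 < t) : shiftRight f t = f (t - 1) := by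
  cases t with
  | zero => omega
  | succ t => rfl

/-- This and `alpha_self_raise` treat the last index of the sum, where some of the neighbouring
coefficients are absent. -/
theorem alpha_self_lower {L m n : ℕ} (hmn : m < n) :
    n * alpha L m m (n - 1) = (n + 1) * alpha L m m n := by
  obtain ⟨N, rfl⟩ : ∃ N, n = N + 1 := ⟨n - 1, by omega⟩
  simp only [alpha, Nat.sub_self, poch_zero, Nat.add_sub_cancel, pow_zero]
  push_cast
  field_simp

theorem alpha_self_raise {L m n : ℕ} (hmL : m < L) :
    (L - m) * alpha L (m + 1) (m + 1) n = (L + 1 - m) * alpha L m m n := by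
  obtain ⟨d, rfl⟩ : ∃ d, L = m + 1 + d := ⟨L - (m + 1), by omega⟩
  rw [alpha_eq 0 d (by omega) rfl, alpha_eq 0 (d + 1) (by omega) (by omega), poch_ratio_succ,
    Nat.factorial_succ, Nat.factorial_succ]
  simp only [poch_zero]
  push_cast
  field_simp
  ring

/-- These are the identities between coefficients of sin((n+m-2t)θ) and cos((n+m-2t)θ) needed in
`sin_mul_wcos_lower` and `wcos_lower_sub`. -/
theorem wcoeff_lower_of_lt {L n m : ℕ} (hmn : m < n) (hn : n ≤ L) (t : ℕ) :
    ((n : ℝ) + m + 1 - t) * wcoeff L n m t + (t + 1) * wcoeff L n m (t + 1)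
        = n * wcoeff L (n - 1) m t + m * wcoeff L n (m - 1) t ∧
      ((n : ℝ) + m - 2 * t) * (n * wcoeff L (n - 1) m t - m * wcoeff L n (m - 1) t
          - (n - m) / 2 * (wcoeff L n m t + wcoeff L n m (t + 1)))
        = (n - m) * (n + m + 2) / 2 * (wcoeff L n m t - wcoeff L n m (t + 1)) := by
  rcases lt_trichotomy t m with h | rfl | h
  · obtain ⟨c, h1, h2, h3, h4⟩ := alpha_lower h hmn.le (hmn.le.trans hn)
    rw [wcoeff_of_le hmn.le h.le, wcoeff_of_le hmn.le h, wcoeff_of_le (by omega) h.le,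
      wcoeff_of_le (by omega) (by omega), h1, h2, h3, h4]
    have hm : (t : ℝ) + 1 ≤ m := by exact_mod_cast h
    have hn0 : (n : ℝ) ≠ 0 := by exact_mod_cast (by omega : n ≠ 0)
    have : (n : ℝ) + 2 + (m - t - 1) ≠ 0 := by
      have : (0 : ℝ) ≤ n := by positivity
      intro; linarith
    constructor
    · field_simp
      ring
    · field_simp
      ring
  · have e : (t : ℝ) * wcoeff L n (t - 1) t = 0 := by
      rcases Nat.eq_zero_or_pos t with rfl | ht
      · simp
      · rw [wcoeff_of_lt_right (by omega), mul_zero]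
    rw [e, wcoeff_of_le hmn.le le_rfl, wcoeff_of_lt_right (Nat.lt_succ_self t),
      wcoeff_of_le (by omega) le_rfl, alpha_self_lower hmn]
    constructor <;> ring
  · rw [wcoeff_of_lt_right h, wcoeff_of_lt_right (h.trans (Nat.lt_succ_self t)),
      wcoeff_of_lt_right h, wcoeff_of_lt_right (by omega)]
    simp

/-- The index `t = n` must be excluded: there the right side vanishes and the left does not. The
exception is harmless, since that coefficient multiplies sin 0. -/
theorem wcoeff_lower_diag {L n : ℕ} (hn : n ≤ L) {t : ℕ} (ht : t ≠ n) :
    ((n : ℝ) + n + 1 - t) * wcoeff L n n t + (t + 1) * wcoeff L n n (t + 1)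
        = n * wcoeff L (n - 1) n t + n * wcoeff L n (n - 1) t := by
  rw [wcoeff_comm L (n - 1) n]
  rcases ht.lt_or_gt with h | h
  · obtain ⟨c, h1, h2, -, h4⟩ := alpha_lower h le_rfl hn
    rw [wcoeff_of_le le_rfl h.le, wcoeff_of_le le_rfl h, wcoeff_of_le (by omega) (by omega),
      h1, h2, h4]
    have hm : (t : ℝ) + 1 ≤ n := by exact_mod_cast h
    have : (n : ℝ) + 2 + (n - t - 1) ≠ 0 := by
      have : (0 : ℝ) ≤ n := by positivity
      intro; linarith
    field_simp
    ring
  · rw [wcoeff_of_lt_right h, wcoeff_of_lt_right (h.trans (Nat.lt_succ_self t)),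
      wcoeff_of_lt_right (by omega)]
    simp

theorem shiftRight_alpha_of_raise {L m n t : ℕ} {c : ℝ} (hmn : m ≤ n) (ht : t ≤ m)
    (h : 0 < t → alpha L (t - 1) m n
      = -c * (n - L + (m - t)) * t / ((n + 1) * (n + 2 + (m - t)) * (L + 2 - t))) :
    shiftRight (wcoeff L n m) t
      = -c * (n - L + (m - t)) * t / ((n + 1) * (n + 2 + (m - t)) * (L + 2 - t)) := by
  rcases Nat.eq_zero_or_pos t with rfl | h0
  · simp [shiftRight]
  · rw [shiftRight_of_pos _ h0, wcoeff_of_le hmn (by omega), h h0]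

theorem wcoeff_raise_of_lt {L n m : ℕ} (hmn : m < n) (hn : n ≤ L) (t : ℕ) :
    ((L : ℝ) - n - m + t) * wcoeff L n m t + (L + 2 - t) * shiftRight (wcoeff L n m) t
        = (L - n) * wcoeff L (n + 1) m t + (L - m) * wcoeff L n (m + 1) t ∧
      ((n : ℝ) + m + 2 - 2 * t) * ((L - n) * wcoeff L (n + 1) m t - (L - m) * wcoeff L n (m + 1) t
          + (n - m) / 2 * (wcoeff L n m t + shiftRight (wcoeff L n m) t))
        = (n - m) * (2 * L + 2 - n - m) / 2
          * (wcoeff L n m t - shiftRight (wcoeff L n m) t) := by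
  rcases Nat.lt_or_ge m t with h | h
  · rw [wcoeff_of_lt_right h, wcoeff_of_lt_right h, shiftRight_of_pos _ (by omega)]
    rcases (by omega : t = m + 1 ∨ m + 1 < t) with rfl | h'
    · rw [Nat.add_sub_cancel, wcoeff_of_le hmn.le le_rfl, wcoeff_of_le hmn le_rfl,
        alpha_self_raise (by omega)]
      push_cast
      constructor <;> ring
    · rw [wcoeff_of_lt_right (by omega), wcoeff_of_lt_right h']
      simp
  · obtain ⟨c, h1, h2, h3, h4⟩ := alpha_raise h hmn.le (hmn.le.trans hn)
    rw [shiftRight_alpha_of_raise hmn.le h h2, wcoeff_of_le hmn.le h, wcoeff_of_le (by omega) h,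
      wcoeff_of_le (by omega) (by omega), h1, h3, h4 (by omega)]
    have hm : (t : ℝ) ≤ m := by exact_mod_cast h
    have hL : (m : ℝ) ≤ L := by exact_mod_cast (by omega)
    have : (n : ℝ) + 2 + (m - t) ≠ 0 := by
      have : (0 : ℝ) ≤ n := by positivity
      intro; linarith
    have : (L : ℝ) + 2 - t ≠ 0 := by
      intro; linarith
    constructor
    · field_simp
      ring
    · field_simp
      ring

/-- As in the lowering case, the excluded index is the one whose frequency 2n + 2 - 2t is zero. -/
theorem wcoeff_raise_diag {L n : ℕ} (hn : n ≤ L) {t : ℕ} (ht : t ≠ n + 1) :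
    ((L : ℝ) - n - n + t) * wcoeff L n n t + (L + 2 - t) * shiftRight (wcoeff L n n) t
        = (L - n) * wcoeff L (n + 1) n t + (L - n) * wcoeff L n (n + 1) t := by
  rw [wcoeff_comm L n (n + 1)]
  rcases Nat.lt_or_ge n t with h | h
  · rw [wcoeff_of_lt_right h, wcoeff_of_lt_right h, shiftRight_of_pos _ (by omega),
      wcoeff_of_lt_right (by omega)]
    simp
  · obtain ⟨c, h1, h2, h3, -⟩ := alpha_raise h le_rfl hn
    rw [shiftRight_alpha_of_raise le_rfl h h2, wcoeff_of_le le_rfl h, wcoeff_of_le (by omega) h,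
      h1, h3]
    have hm : (t : ℝ) ≤ n := by exact_mod_cast h
    have hL : (n : ℝ) ≤ L := by exact_mod_cast (by omega)
    have : (n : ℝ) + 2 + (n - t) ≠ 0 := by
      have : (0 : ℝ) ≤ n := by positivity
      intro; linarith
    have : (L : ℝ) + 2 - t ≠ 0 := by
      intro; linarith
    field_simp
    ring

/-! ### The weight as a sine polynomial -/

/-- The factor `s` stands for the sine of frequency n + m - 2t; its vanishing at frequency zero
absorbs the diagonal exception. -/
theorem wcoeff_lower_mul {L n m : ℕ} (hn : n ≤ L) (hm : m ≤ L) (t : ℕ) {s : ℝ}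
    (hs : (n : ℝ) + m - 2 * t = 0 → s = 0) :
    (((n : ℝ) + m + 1 - t) * wcoeff L n m t + (t + 1) * wcoeff L n m (t + 1)) * s
      = (n * wcoeff L (n - 1) m t + m * wcoeff L n (m - 1) t) * s := by
  rcases lt_trichotomy m n with h | rfl | h
  · rw [(wcoeff_lower_of_lt h hn t).1]
  · by_cases ht : t = m
    · rw [hs (by rw [ht]; ring), mul_zero, mul_zero]
    · rw [wcoeff_lower_diag hn ht]
  · have := (wcoeff_lower_of_lt h hm t).1
    rw [wcoeff_comm L m, wcoeff_comm L m, wcoeff_comm L (m - 1), wcoeff_comm L m] at this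
    linear_combination s * this

theorem wcoeff_lower_sub {L n m : ℕ} (hn : n ≤ L) (hm : m ≤ L) (t : ℕ) :
    ((n : ℝ) + m - 2 * t) * (n * wcoeff L (n - 1) m t - m * wcoeff L n (m - 1) t
        - (n - m) / 2 * (wcoeff L n m t + wcoeff L n m (t + 1)))
      = (n - m) * (n + m + 2) / 2 * (wcoeff L n m t - wcoeff L n m (t + 1)) := by
  rcases lt_trichotomy m n with h | rfl | h
  · exact (wcoeff_lower_of_lt h hn t).2
  · rw [wcoeff_comm L (m - 1)]
    ring
  · have := (wcoeff_lower_of_lt h hm t).2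
    rw [wcoeff_comm L m, wcoeff_comm L m, wcoeff_comm L (m - 1), wcoeff_comm L m] at this
    linear_combination -this

theorem shiftRight_wcoeff_comm (L n m : ℕ) :
    shiftRight (wcoeff L n m) = shiftRight (wcoeff L m n) := by
  congr 1
  ext t
  exact wcoeff_comm L n m t

theorem wcoeff_raise_mul {L n m : ℕ} (hn : n ≤ L) (hm : m ≤ L) (t : ℕ) {s : ℝ}
    (hs : (n : ℝ) + m + 2 - 2 * t = 0 → s = 0) :
    (((L : ℝ) - n - m + t) * wcoeff L n m t + (L + 2 - t) * shiftRight (wcoeff L n m) t) * s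
      = ((L - n) * wcoeff L (n + 1) m t + (L - m) * wcoeff L n (m + 1) t) * s := by
  rcases lt_trichotomy m n with h | rfl | h
  · rw [(wcoeff_raise_of_lt h hn t).1]
  · by_cases ht : t = m + 1
    · rw [hs (by rw [ht]; push_cast; ring), mul_zero, mul_zero]
    · rw [wcoeff_raise_diag hn ht]
  · have := (wcoeff_raise_of_lt h hm t).1
    rw [wcoeff_comm L m, shiftRight_wcoeff_comm L m, wcoeff_comm L (m + 1), wcoeff_comm L m] at this
    linear_combination s * this

theorem wcoeff_raise_sub {L n m : ℕ} (hn : n ≤ L) (hm : m ≤ L) (t : ℕ) :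
    ((n : ℝ) + m + 2 - 2 * t) * ((L - n) * wcoeff L (n + 1) m t - (L - m) * wcoeff L n (m + 1) t
        + (n - m) / 2 * (wcoeff L n m t + shiftRight (wcoeff L n m) t))
      = (n - m) * (2 * L + 2 - n - m) / 2
        * (wcoeff L n m t - shiftRight (wcoeff L n m) t) := by
  rcases lt_trichotomy m n with h | rfl | h
  · exact (wcoeff_raise_of_lt h hn t).2
  · rw [wcoeff_comm L (m + 1)]
    ring
  · have := (wcoeff_raise_of_lt h hm t).2
    rw [wcoeff_comm L m, shiftRight_wcoeff_comm L m, wcoeff_comm L (m + 1), wcoeff_comm L m] at this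
    linear_combination -this

theorem sum_range_mul_eq_sum_succ {N : ℕ} {a g : ℕ → ℝ} (ha : a N = 0) (hg : g 0 = 0) :
    ∑ t ∈ Finset.range N, a t * g t = ∑ t ∈ Finset.range N, a (t + 1) * g (t + 1) := by
  have h1 := Finset.sum_range_succ (fun t => a t * g t) N
  have h2 := Finset.sum_range_succ' (fun t => a t * g t) N
  simp only [ha, hg, zero_mul, mul_zero, add_zero] at h1 h2
  rw [← h1, h2]

theorem sum_range_mul_succ_eq_sum_shiftRight {N : ℕ} {a g : ℕ → ℝ} (ha : a N = 0) :
    ∑ t ∈ Finset.range (N + 1), a t * g (t + 1)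
      = ∑ t ∈ Finset.range (N + 1), shiftRight a t * g t := by
  rw [Finset.sum_range_succ, ha, zero_mul, add_zero, Finset.sum_range_succ']
  simp [shiftRight]

theorem wcoeff_eq_zero {L n m t : ℕ} (hn : n ≤ L) (ht : L < t) : wcoeff L n m t = 0 :=
  wcoeff_of_lt_left (hn.trans_lt ht)

/-- The entry `(n, m)` of the weight at `cos θ`. -/
def wsin (L n m : ℕ) (θ : ℝ) : ℝ :=
  ∑ t ∈ Finset.range (L + 2), wcoeff L n m t * Real.sin (((n : ℝ) + m + 1 - 2 * t) * θ)

/-- The derivative of `wsin`. -/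
def wcos (L n m : ℕ) (θ : ℝ) : ℝ :=
  ∑ t ∈ Finset.range (L + 2), wcoeff L n m t *
    (((n : ℝ) + m + 1 - 2 * t) * Real.cos (((n : ℝ) + m + 1 - 2 * t) * θ))

theorem wsin_comm (L n m : ℕ) (θ : ℝ) : wsin L n m θ = wsin L m n θ := by
  simp only [wsin, wcoeff_comm L n m, add_comm (n : ℝ) m]

theorem wcos_comm (L n m : ℕ) (θ : ℝ) : wcos L n m θ = wcos L m n θ := by
  simp only [wcos, wcoeff_comm L n m, add_comm (n : ℝ) m]

theorem hasDerivAt_wsin (L n m : ℕ) (θ : ℝ) : HasDerivAt (wsin L n m) (wcos L n m θ) θ := by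
  unfold wsin wcos
  refine HasDerivAt.fun_sum fun t _ => HasDerivAt.const_mul _ ?_
  have := ((hasDerivAt_id θ).const_mul ((n : ℝ) + m + 1 - 2 * t)).sin
  simpa [mul_comm] using this

/-- The factor `n` is kept so that the truncated `n - 1` does no harm at `n = 0`. -/
theorem natCast_mul_wsin_pred_left (L n m : ℕ) (θ : ℝ) :
    n * wsin L (n - 1) m θ = ∑ t ∈ Finset.range (L + 2),
      n * wcoeff L (n - 1) m t * Real.sin (((n : ℝ) + m - 2 * t) * θ) := by
  rcases n with _ | n
  · simp
  · rw [wsin, Finset.mul_sum, Nat.add_sub_cancel]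
    refine Finset.sum_congr rfl fun t _ => ?_
    push_cast
    ring_nf

theorem natCast_mul_wsin_pred_right (L n m : ℕ) (θ : ℝ) :
    m * wsin L n (m - 1) θ = ∑ t ∈ Finset.range (L + 2),
      m * wcoeff L n (m - 1) t * Real.sin (((n : ℝ) + m - 2 * t) * θ) := by
  rw [wsin_comm, natCast_mul_wsin_pred_left]
  simp only [wcoeff_comm L n, add_comm (n : ℝ)]

theorem natCast_mul_wcos_pred_left (L n m : ℕ) (θ : ℝ) :
    n * wcos L (n - 1) m θ = ∑ t ∈ Finset.range (L + 2),
      n * wcoeff L (n - 1) m t * (((n : ℝ) + m - 2 * t) * Real.cos (((n : ℝ) + m - 2 * t) * θ)) := by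
  rcases n with _ | n
  · simp
  · rw [wcos, Finset.mul_sum, Nat.add_sub_cancel]
    refine Finset.sum_congr rfl fun t _ => ?_
    push_cast
    ring_nf

theorem natCast_mul_wcos_pred_right (L n m : ℕ) (θ : ℝ) :
    m * wcos L n (m - 1) θ = ∑ t ∈ Finset.range (L + 2),
      m * wcoeff L n (m - 1) t * (((n : ℝ) + m - 2 * t) * Real.cos (((n : ℝ) + m - 2 * t) * θ)) := by
  rw [wcos_comm, natCast_mul_wcos_pred_left]
  simp only [wcoeff_comm L n, add_comm (n : ℝ)]

theorem wsin_succ_left (L n m : ℕ) (θ : ℝ) :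
    wsin L (n + 1) m θ = ∑ t ∈ Finset.range (L + 2),
      wcoeff L (n + 1) m t * Real.sin (((n : ℝ) + m + 2 - 2 * t) * θ) := by
  rw [wsin]
  refine Finset.sum_congr rfl fun t _ => ?_
  push_cast
  ring_nf

theorem wsin_succ_right (L n m : ℕ) (θ : ℝ) :
    wsin L n (m + 1) θ = ∑ t ∈ Finset.range (L + 2),
      wcoeff L n (m + 1) t * Real.sin (((n : ℝ) + m + 2 - 2 * t) * θ) := by
  rw [wsin_comm, wsin_succ_left]
  simp only [wcoeff_comm L n, add_comm (n : ℝ)]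

theorem wcos_succ_left (L n m : ℕ) (θ : ℝ) :
    wcos L (n + 1) m θ = ∑ t ∈ Finset.range (L + 2), wcoeff L (n + 1) m t *
      (((n : ℝ) + m + 2 - 2 * t) * Real.cos (((n : ℝ) + m + 2 - 2 * t) * θ)) := by
  rw [wcos]
  refine Finset.sum_congr rfl fun t _ => ?_
  push_cast
  ring_nf

theorem wcos_succ_right (L n m : ℕ) (θ : ℝ) :
    wcos L n (m + 1) θ = ∑ t ∈ Finset.range (L + 2), wcoeff L n (m + 1) t *
      (((n : ℝ) + m + 2 - 2 * t) * Real.cos (((n : ℝ) + m + 2 - 2 * t) * θ)) := by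
  rw [wcos_comm, wcos_succ_left]
  simp only [wcoeff_comm L n, add_comm (n : ℝ)]

/-! ### Lowering and raising identities for the sine polynomials -/

/-- Since -sin θ d/dθ = (1-x²) d/dx, the left side is (1-x²)W' + xW. The addition formulas split
each term of frequency k into frequencies k ± 1; shifting the index of the upper ones makes the
claim the contiguous relation, coefficient by coefficient. -/
theorem sin_mul_wcos_lower {L n m : ℕ} (hn : n ≤ L) (hm : m ≤ L) (θ : ℝ) :
    -(Real.sin θ * wcos L n m θ) + Real.cos θ * wsin L n m θ
      = n * wsin L (n - 1) m θ + m * wsin L n (m - 1) θ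
        - (n + m) * (Real.cos θ * wsin L n m θ) := by
  have key : -(Real.sin θ * wcos L n m θ) + (n + m + 1) * (Real.cos θ * wsin L n m θ)
      = n * wsin L (n - 1) m θ + m * wsin L n (m - 1) θ := by
    have e1 : -(Real.sin θ * wcos L n m θ) + (n + m + 1) * (Real.cos θ * wsin L n m θ)
        = ∑ t ∈ Finset.range (L + 2), wcoeff L n m t *
            ((n + m + 1 - t) * Real.sin (((n : ℝ) + m - 2 * t) * θ))
          + ∑ t ∈ Finset.range (L + 2), wcoeff L n m t *
            (t * Real.sin (((n : ℝ) + m + 2 - 2 * t) * θ)) := by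
      rw [wcos, wsin, Finset.mul_sum, Finset.mul_sum, Finset.mul_sum, ← Finset.sum_neg_distrib,
        ← Finset.sum_add_distrib, ← Finset.sum_add_distrib]
      refine Finset.sum_congr rfl fun t _ => ?_
      rw [show ((n : ℝ) + m - 2 * t) * θ = ((n : ℝ) + m + 1 - 2 * t) * θ - θ by ring,
        show ((n : ℝ) + m + 2 - 2 * t) * θ = ((n : ℝ) + m + 1 - 2 * t) * θ + θ by ring,
        Real.sin_sub, Real.sin_add]
      ring
    rw [e1, sum_range_mul_eq_sum_succ
        (g := fun t : ℕ => t * Real.sin (((n : ℝ) + m + 2 - 2 * t) * θ))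
        (wcoeff_eq_zero hn (by omega)) (by simp),
      natCast_mul_wsin_pred_left, natCast_mul_wsin_pred_right,
      ← Finset.sum_add_distrib, ← Finset.sum_add_distrib]
    refine Finset.sum_congr rfl fun t _ => ?_
    have := wcoeff_lower_mul hn hm t (s := Real.sin (((n : ℝ) + m - 2 * t) * θ))
      (fun h => by rw [h]; simp)
    rw [show (n : ℝ) + m + 2 - 2 * (t + 1 : ℕ) = n + m - 2 * t by push_cast; ring]
    push_cast
    linear_combination this
  linear_combination key

theorem sin_mul_wcos_raise {L n m : ℕ} (hn : n ≤ L) (hm : m ≤ L) (θ : ℝ) :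
    -(Real.sin θ * wcos L n m θ) + Real.cos θ * wsin L n m θ
      = (L - n) * wsin L (n + 1) m θ + (L - m) * wsin L n (m + 1) θ
        - (2 * L - n - m) * (Real.cos θ * wsin L n m θ) := by
  have key : -(Real.sin θ * wcos L n m θ) + (2 * L - n - m + 1) * (Real.cos θ * wsin L n m θ)
      = (L - n) * wsin L (n + 1) m θ + (L - m) * wsin L n (m + 1) θ := by
    have e1 : -(Real.sin θ * wcos L n m θ) + (2 * L - n - m + 1) * (Real.cos θ * wsin L n m θ)
        = ∑ t ∈ Finset.range (L + 2), wcoeff L n m t *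
            ((L - n - m + t) * Real.sin (((n : ℝ) + m + 2 - 2 * t) * θ))
          + ∑ t ∈ Finset.range (L + 2), wcoeff L n m t *
            ((L + 2 - (t + 1 : ℕ)) * Real.sin (((n : ℝ) + m + 2 - 2 * (t + 1 : ℕ)) * θ)) := by
      rw [wcos, wsin, Finset.mul_sum, Finset.mul_sum, Finset.mul_sum, ← Finset.sum_neg_distrib,
        ← Finset.sum_add_distrib, ← Finset.sum_add_distrib]
      refine Finset.sum_congr rfl fun t _ => ?_
      rw [show ((n : ℝ) + m + 2 - 2 * (t + 1 : ℕ)) * θ = ((n : ℝ) + m + 1 - 2 * t) * θ - θ by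
          push_cast; ring,
        show ((n : ℝ) + m + 2 - 2 * t) * θ = ((n : ℝ) + m + 1 - 2 * t) * θ + θ by ring,
        Real.sin_sub, Real.sin_add]
      push_cast
      ring
    -- Here the lower frequencies move up one index. The range `L + 2` has room for this because the
    -- coefficient at `t = L + 1` is zero.
    rw [e1, sum_range_mul_succ_eq_sum_shiftRight
        (g := fun t : ℕ => ((L : ℝ) + 2 - t) * Real.sin (((n : ℝ) + m + 2 - 2 * t) * θ))
        (wcoeff_eq_zero hn (by omega)),
      wsin_succ_left, wsin_succ_right, Finset.mul_sum, Finset.mul_sum,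
      ← Finset.sum_add_distrib, ← Finset.sum_add_distrib]
    refine Finset.sum_congr rfl fun t _ => ?_
    have := wcoeff_raise_mul hn hm t (s := Real.sin (((n : ℝ) + m + 2 - 2 * t) * θ))
      (fun h => by rw [h]; simp)
    linear_combination this
  linear_combination key

/-- The left side is the θ-derivative of n·w_{n-1,m} - m·w_{n,m-1} - (n-m) cos θ·w_{n,m}. The proof
again compares frequencies, now of cosines; no diagonal exception arises because differentiation
supplies the factor n + m - 2t. -/
theorem wcos_lower_sub {L n m : ℕ} (hn : n ≤ L) (hm : m ≤ L) (θ : ℝ) :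
    n * wcos L (n - 1) m θ - m * wcos L n (m - 1) θ
        - (n - m) * (-Real.sin θ * wsin L n m θ + Real.cos θ * wcos L n m θ)
      = (n - m) * (n + m + 2) * (Real.sin θ * wsin L n m θ) := by
  have e1 : (n - m) * (-Real.sin θ * wsin L n m θ + Real.cos θ * wcos L n m θ)
        + (n - m) * (n + m + 2) * (Real.sin θ * wsin L n m θ)
      = ∑ t ∈ Finset.range (L + 2), wcoeff L n m t *
          ((n - m) * (n + m + 1 - t) * Real.cos (((n : ℝ) + m - 2 * t) * θ))
        + ∑ t ∈ Finset.range (L + 2), wcoeff L n m t *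
          (-(n - m) * t * Real.cos (((n : ℝ) + m + 2 - 2 * t) * θ)) := by
    rw [wcos, wsin, Finset.mul_sum, Finset.mul_sum, Finset.mul_sum, ← Finset.sum_add_distrib,
      Finset.mul_sum, Finset.mul_sum, ← Finset.sum_add_distrib, ← Finset.sum_add_distrib]
    refine Finset.sum_congr rfl fun t _ => ?_
    rw [show ((n : ℝ) + m - 2 * t) * θ = ((n : ℝ) + m + 1 - 2 * t) * θ - θ by ring,
      show ((n : ℝ) + m + 2 - 2 * t) * θ = ((n : ℝ) + m + 1 - 2 * t) * θ + θ by ring,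
      Real.cos_sub, Real.cos_add]
    ring
  rw [sum_range_mul_eq_sum_succ
      (g := fun t : ℕ => -((n : ℝ) - m) * t * Real.cos (((n : ℝ) + m + 2 - 2 * t) * θ))
      (wcoeff_eq_zero hn (by omega)) (by simp)] at e1
  have e2 : n * wcos L (n - 1) m θ - m * wcos L n (m - 1) θ
      = ∑ t ∈ Finset.range (L + 2), wcoeff L n m t *
          ((n - m) * (n + m + 1 - t) * Real.cos (((n : ℝ) + m - 2 * t) * θ))
        + ∑ t ∈ Finset.range (L + 2), wcoeff L n m (t + 1) *
          (-((n : ℝ) - m) * (t + 1 : ℕ) *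
            Real.cos (((n : ℝ) + m + 2 - 2 * (t + 1 : ℕ)) * θ)) := by
    rw [natCast_mul_wcos_pred_left, natCast_mul_wcos_pred_right,
      ← Finset.sum_sub_distrib, ← Finset.sum_add_distrib]
    refine Finset.sum_congr rfl fun t _ => ?_
    have := wcoeff_lower_sub hn hm t
    rw [show (n : ℝ) + m + 2 - 2 * (t + 1 : ℕ) = n + m - 2 * t by push_cast; ring]
    push_cast
    linear_combination Real.cos (((n : ℝ) + m - 2 * t) * θ) * this
  linear_combination e2 - e1

theorem wcos_raise_sub {L n m : ℕ} (hn : n ≤ L) (hm : m ≤ L) (θ : ℝ) :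
    (L - n) * wcos L (n + 1) m θ - (L - m) * wcos L n (m + 1) θ
        + (n - m) * (-Real.sin θ * wsin L n m θ + Real.cos θ * wcos L n m θ)
      = -((n - m) * (2 * L + 2 - n - m) * (Real.sin θ * wsin L n m θ)) := by
  have e1 : (n - m) * (-Real.sin θ * wsin L n m θ + Real.cos θ * wcos L n m θ)
        + (n - m) * (2 * L + 2 - n - m) * (Real.sin θ * wsin L n m θ)
      = ∑ t ∈ Finset.range (L + 2), wcoeff L n m t *
          (((n : ℝ) - m) * (n + m - L - t) * Real.cos (((n : ℝ) + m + 2 - 2 * t) * θ))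
        + ∑ t ∈ Finset.range (L + 2), wcoeff L n m t * (((n : ℝ) - m) * (L + 2 - (t + 1 : ℕ)) *
          Real.cos (((n : ℝ) + m + 2 - 2 * (t + 1 : ℕ)) * θ)) := by
    rw [wcos, wsin, Finset.mul_sum, Finset.mul_sum, Finset.mul_sum, ← Finset.sum_add_distrib,
      Finset.mul_sum, Finset.mul_sum, ← Finset.sum_add_distrib, ← Finset.sum_add_distrib]
    refine Finset.sum_congr rfl fun t _ => ?_
    rw [show ((n : ℝ) + m + 2 - 2 * (t + 1 : ℕ)) * θ = ((n : ℝ) + m + 1 - 2 * t) * θ - θ by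
        push_cast; ring,
      show ((n : ℝ) + m + 2 - 2 * t) * θ = ((n : ℝ) + m + 1 - 2 * t) * θ + θ by ring,
      Real.cos_sub, Real.cos_add]
    push_cast
    ring
  rw [sum_range_mul_succ_eq_sum_shiftRight
      (g := fun t : ℕ => ((n : ℝ) - m) * (L + 2 - t) * Real.cos (((n : ℝ) + m + 2 - 2 * t) * θ))
      (wcoeff_eq_zero hn (by omega))] at e1
  have e2 : (L - n) * wcos L (n + 1) m θ - (L - m) * wcos L n (m + 1) θ
      = -(∑ t ∈ Finset.range (L + 2), wcoeff L n m t *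
          (((n : ℝ) - m) * (n + m - L - t) * Real.cos (((n : ℝ) + m + 2 - 2 * t) * θ))
        + ∑ t ∈ Finset.range (L + 2), shiftRight (wcoeff L n m) t * (((n : ℝ) - m) *
          (L + 2 - t) * Real.cos (((n : ℝ) + m + 2 - 2 * t) * θ))) := by
    rw [wcos_succ_left, wcos_succ_right, Finset.mul_sum, Finset.mul_sum,
      ← Finset.sum_sub_distrib, ← Finset.sum_add_distrib, ← Finset.sum_neg_distrib]
    refine Finset.sum_congr rfl fun t _ => ?_
    have := wcoeff_raise_sub hn hm t
    linear_combination Real.cos (((n : ℝ) + m + 2 - 2 * t) * θ) * this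
  linear_combination e2 + e1

/-! ### Evaluation of matrix polynomials -/

section Eval

variable {L : ℕ}

theorem evalAt_add (P Q : MatPoly L) (x : ℝ) : evalAt (P + Q) x = evalAt P x + evalAt Q x :=
  eval_add

theorem evalAt_sub (P Q : MatPoly L) (x : ℝ) : evalAt (P - Q) x = evalAt P x - evalAt Q x :=
  eval_sub ..

theorem evalAt_one (x : ℝ) : evalAt (1 : MatPoly L) x = 1 := eval_one

theorem evalAt_C (A : Mat L) (x : ℝ) : evalAt (C A) x = A := eval_C

theorem evalAt_mul (P Q : MatPoly L) (x : ℝ) : evalAt (P * Q) x = evalAt P x * evalAt Q x := by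
  refine eval₂_mul_noncomm (RingHom.id _) _ fun k => ?_
  exact (Matrix.scalar_commute (x : ℂ) (Commute.all _) _).symm

theorem evalAt_X (x : ℝ) : evalAt (X : MatPoly L) x = (x : ℂ) • (1 : Mat L) := by
  rw [evalAt, eval_X, Matrix.scalar_apply, Matrix.smul_one_eq_diagonal]

theorem evalAt_monomial (k : ℕ) (A : Mat L) (x : ℝ) :
    evalAt (monomial k A) x = ((x : ℂ) ^ k) • A := by
  rw [evalAt, eval_monomial, ← map_pow, Matrix.scalar_apply, ← Matrix.smul_one_eq_diagonal,
    mul_smul_comm, mul_one]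

theorem continuous_evalAt (P : MatPoly L) : Continuous (evalAt P) := by
  induction P using Polynomial.induction_on' with
  | add P Q hP hQ =>
    have : evalAt (P + Q) = fun x => evalAt P x + evalAt Q x := funext (evalAt_add P Q)
    rw [this]
    exact hP.add hQ
  | monomial k A =>
    have : evalAt (monomial k A) = fun x : ℝ => ((x : ℂ) ^ k) • A := funext (evalAt_monomial k A)
    rw [this]
    fun_prop

/-- Entrywise differentiability of matrix-valued functions. -/
def HasEntryDerivAt (F : ℝ → Mat L) (F' : Mat L) (x : ℝ) : Prop :=
  ∀ i j, HasDerivAt (fun y => F y i j) (F' i j) x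

namespace HasEntryDerivAt

variable {F G : ℝ → Mat L} {F' G' : Mat L} {x : ℝ}

theorem congr_deriv (h : HasEntryDerivAt F F' x) (e : F' = G') : HasEntryDerivAt F G' x := e ▸ h

theorem const (A : Mat L) : HasEntryDerivAt (fun _ => A) 0 x := fun i j => hasDerivAt_const x (A i j)

theorem add (hF : HasEntryDerivAt F F' x) (hG : HasEntryDerivAt G G' x) :
    HasEntryDerivAt (fun y => F y + G y) (F' + G') x := fun i j => (hF i j).add (hG i j)

theorem sub (hF : HasEntryDerivAt F F' x) (hG : HasEntryDerivAt G G' x) :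
    HasEntryDerivAt (fun y => F y - G y) (F' - G') x := fun i j => (hF i j).sub (hG i j)

theorem smul {c : ℝ → ℝ} {c' : ℝ} (hc : HasDerivAt c c' x) (hF : HasEntryDerivAt F F' x) :
    HasEntryDerivAt (fun y => c y • F y) (c x • F' + c' • F x) x := fun i j => hc.smul (hF i j)

theorem mul (hF : HasEntryDerivAt F F' x) (hG : HasEntryDerivAt G G' x) :
    HasEntryDerivAt (fun y => F y * G y) (F' * G x + F x * G') x := fun i j => by
  simp only [Matrix.mul_apply, Matrix.add_apply, ← Finset.sum_add_distrib]
  exact HasDerivAt.fun_sum fun k _ => (hF i k).mul (hG k j)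

theorem conjTranspose (hF : HasEntryDerivAt F F' x) :
    HasEntryDerivAt (fun y => (F y).conjTranspose) F'.conjTranspose x := fun i j => (hF j i).star

end HasEntryDerivAt

theorem hasEntryDerivAt_evalAt (P : MatPoly L) (x : ℝ) :
    HasEntryDerivAt (evalAt P) (evalAt (derivative P) x) x := by
  induction P using Polynomial.induction_on' with
  | add P Q hP hQ =>
    have : evalAt (P + Q) = fun x => evalAt P x + evalAt Q x := funext (evalAt_add P Q)
    rw [this, derivative_add, evalAt_add]
    exact hP.add hQ
  | monomial k A =>
    intro i j
    have : evalAt (monomial k A) = fun x : ℝ => ((x : ℂ) ^ k) • A := funext (evalAt_monomial k A)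
    rw [this, derivative_monomial, evalAt_monomial]
    have h := ((hasDerivAt_pow k (x : ℂ)).comp_ofReal).mul_const (A i j)
    refine h.congr_deriv ?_
    rw [← nsmul_eq_mul', Matrix.smul_apply, Matrix.smul_apply]
    simp
    ring

theorem opD_act (P : MatPoly L) :
    (opD L).act P = derivative (derivative P) * (1 - X ^ 2)
      + derivative P * (C (matC L) - X * C (matU L)) - P * C (matV L) := by
  have h : (opD L).act P = ∑ i : Fin 3, (derivative^[(i : ℕ)] P) * opD L i := rfl
  rw [h, Fin.sum_univ_three]
  simp only [opD, Fin.val_zero, Fin.val_one, Fin.val_two, Function.iterate_zero,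
    Function.iterate_succ, Function.comp, id, Matrix.cons_val_zero, Matrix.cons_val_one,
    Matrix.cons_val]
  have e : P * -C (matV L) = -(P * C (matV L)) := mul_neg P (C (matV L))
  rw [e]
  abel

theorem opE_act (P : MatPoly L) :
    (opE L).act P = derivative P * (C (matB0 L) + X * C (matB1 L)) + P * C (matA L) := by
  have h : (opE L).act P = ∑ i : Fin 2, (derivative^[(i : ℕ)] P) * opE L i := rfl
  rw [h, Fin.sum_univ_two]
  simp only [opE, Fin.val_zero, Fin.val_one, Function.iterate_zero, Function.iterate_succ,
    Function.comp, id, Matrix.cons_val_zero, Matrix.cons_val_one]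
  abel

theorem evalAt_X_mul_C (A : Mat L) (x : ℝ) : evalAt (X * C A) x = x • A := by
  rw [evalAt_mul, evalAt_X, evalAt_C, smul_mul_assoc, one_mul]
  rfl

theorem evalAt_opD (P : MatPoly L) (x : ℝ) :
    evalAt ((opD L).act P) x = (1 - x ^ 2) • evalAt (derivative (derivative P)) x
      + evalAt (derivative P) x * (matC L - x • matU L) - evalAt P x * matV L := by
  have h1 : evalAt (1 - X ^ 2 : MatPoly L) x = (1 - x ^ 2) • (1 : Mat L) := by
    have h := evalAt_monomial 2 (1 : Mat L) x
    rw [← X_pow_eq_monomial] at h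
    rw [evalAt_sub, evalAt_one, h, sub_smul, one_smul]
    norm_cast
  rw [opD_act, evalAt_sub, evalAt_add, evalAt_mul, evalAt_mul, evalAt_mul, h1, evalAt_sub,
    evalAt_X_mul_C, evalAt_C, evalAt_C, mul_smul_comm, mul_one]

theorem evalAt_opE (P : MatPoly L) (x : ℝ) :
    evalAt ((opE L).act P) x = evalAt (derivative P) x * (matB0 L + x • matB1 L)
      + evalAt P x * matA L := by
  rw [opE_act, evalAt_add, evalAt_mul, evalAt_mul, evalAt_add, evalAt_X_mul_C, evalAt_C, evalAt_C]

end Eval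

/-! ### Regularity of the weight -/

theorem continuous_weightEntry (L n m : ℕ) : Continuous (weightEntry L n m) := by
  unfold weightEntry
  fun_prop

theorem continuous_weight (L : ℕ) : Continuous (weight L) := by
  refine continuous_matrix fun i j => ?_
  simp only [weight, Matrix.of_apply]
  split_ifs
  · exact Complex.continuous_ofReal.comp (continuous_weightEntry _ _ _)
  · exact Complex.continuous_ofReal.comp (continuous_weightEntry _ _ _)

theorem weight_eq_zero {L : ℕ} {x : ℝ} (hx : x ^ 2 = 1) : weight L x = 0 := by
  ext i j
  simp [weight, weightEntry, hx]

theorem continuous_inner_integrand {L : ℕ} (P Q : MatPoly L) :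
    Continuous fun x => evalAt P x * weight L x * (evalAt Q x).conjTranspose :=
  ((continuous_evalAt P).matrix_mul (continuous_weight L)).matrix_mul
    (continuous_evalAt Q).matrix_conjTranspose

/-- The link with trigonometry is U_k(cos θ) sin θ = sin((k+1)θ); the terms with `t` beyond `m` are
padding by zero. -/
theorem weight_apply_eq_wsin {L : ℕ} {x : ℝ} (hx : x ∈ Set.Icc (-1 : ℝ) 1) (i j : Fin (L + 1)) :
    weight L x i j = (wsin L i j (Real.arccos x) : ℂ) := by
  have key : ∀ n m : ℕ, m ≤ n → n ≤ L → weightEntry L n m x = wsin L n m (Real.arccos x) := by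
    intro n m hmn hn
    rw [weightEntry, wsin, Finset.mul_sum]
    symm
    rw [← Finset.sum_subset (Finset.range_mono (show m + 1 ≤ L + 2 by omega))]
    · refine Finset.sum_congr rfl fun t ht => ?_
      have := Chebyshev.U_real_cos (Real.arccos x) ((n : ℤ) + m - 2 * t)
      rw [Real.cos_arccos hx.1 hx.2, Real.sin_arccos] at this
      rw [wcoeff_of_le hmn (by simpa [Nat.lt_succ_iff] using ht), mul_left_comm, mul_comm √_, this]
      push_cast
      ring_nf
    · intro t _ ht
      rw [wcoeff_of_lt_right (by simpa using ht), zero_mul]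
  have hi := i.is_le
  have hj := j.is_le
  simp only [weight, Matrix.of_apply]
  split_ifs with h
  · rw [key _ _ h hi]
  · rw [key _ _ (by omega) hj, wsin_comm]

/-! ### Symmetry of second-order operators -/

/-- An operator `φ d²/dx² + (d/dx)(A₀ + x A₁) + F₀` is symmetric if the weight satisfies the
corresponding Pearson equations. -/
theorem isSymmetric_of_pearson {L s : ℕ} {T : DiffOp L s} {dW : ℝ → Mat L} {φ φ' : ℝ → ℝ}
    {A₀ A₁ F₀ : Mat L} (hφ : ∀ x, HasDerivAt φ (φ' x) x)
    (hT : ∀ P x, evalAt (T.act P) x = φ x • evalAt (derivative (derivative P)) x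
      + evalAt (derivative P) x * (A₀ + x • A₁) + evalAt P x * F₀)
    (hW : ∀ x ∈ Set.Ioo (-1 : ℝ) 1, HasEntryDerivAt (weight L) (dW x) x)
    (h1 : ∀ x ∈ Set.Ioo (-1 : ℝ) 1, φ x • dW x + φ' x • weight L x
      = (1 / 2 : ℝ) • ((A₀ + x • A₁) * weight L x + weight L x * (A₀ + x • A₁).conjTranspose))
    (h2 : ∀ x ∈ Set.Ioo (-1 : ℝ) 1, A₁ * weight L x + (A₀ + x • A₁) * dW x
        - (weight L x * A₁.conjTranspose + dW x * (A₀ + x • A₁).conjTranspose)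
      = (2 : ℝ) • (F₀ * weight L x - weight L x * F₀.conjTranspose)) :
    T.IsSymmetric := by
  intro P Q
  -- With F = A₀ + xA₁, this is the bilinear concomitant φ(P'WQ* - PWQ'*) + ½P(FW - WF*)Q*. The
  -- Pearson equations make its derivative the difference of the two integrands.
  set f : ℝ → Mat L := fun x =>
    φ x • (evalAt (derivative P) x * weight L x * (evalAt Q x).conjTranspose
      - evalAt P x * weight L x * (evalAt (derivative Q) x).conjTranspose)
    + (1 / 2 : ℝ) • (evalAt P x * ((A₀ + x • A₁) * weight L x
        - weight L x * (A₀ + x • A₁).conjTranspose) * (evalAt Q x).conjTranspose) with hf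
  have hφc : Continuous φ := continuous_iff_continuousAt.2 fun x => (hφ x).continuousAt
  have hF : Continuous fun x : ℝ => A₀ + x • A₁ := by fun_prop
  have hfc : Continuous f := by
    have hG : Continuous fun x => evalAt P x * ((A₀ + x • A₁) * weight L x
        - weight L x * (A₀ + x • A₁).conjTranspose) * (evalAt Q x).conjTranspose :=
      ((continuous_evalAt P).matrix_mul ((hF.matrix_mul (continuous_weight L)).sub
        ((continuous_weight L).matrix_mul hF.matrix_conjTranspose))).matrix_mul
          (continuous_evalAt Q).matrix_conjTranspose
    exact (hφc.smul ((continuous_inner_integrand _ _).sub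
      (continuous_inner_integrand _ _))).add (hG.const_smul (1 / 2 : ℝ))
  have hderiv : ∀ x ∈ Set.Ioo (-1 : ℝ) 1, HasEntryDerivAt f
      (evalAt (T.act P) x * weight L x * (evalAt Q x).conjTranspose
        - evalAt P x * weight L x * (evalAt (T.act Q) x).conjTranspose) x := by
    intro x hx
    have hp := hasEntryDerivAt_evalAt P x
    have hp' := hasEntryDerivAt_evalAt (derivative P) x
    have hq := (hasEntryDerivAt_evalAt Q x).conjTranspose
    have hq' := (hasEntryDerivAt_evalAt (derivative Q) x).conjTranspose
    have hw := hW x hx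
    have hF' : HasEntryDerivAt (fun x : ℝ => A₀ + x • A₁) A₁ x :=
      ((HasEntryDerivAt.const A₀).add ((HasEntryDerivAt.const A₁).smul (hasDerivAt_id x))).congr_deriv
        (by simp)
    have hd := ((((hp'.mul hw).mul hq).sub ((hp.mul hw).mul hq')).smul (hφ x)).add
      (((hp.mul ((hF'.mul hw).sub (hw.mul hF'.conjTranspose))).mul hq).smul
        (hasDerivAt_const x (1 / 2 : ℝ)))
    refine hd.congr_deriv ?_
    have e1 := congr(evalAt (derivative P) x * $(h1 x hx) * (evalAt Q x).conjTranspose)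
    have e2 := congr(evalAt P x * $(h1 x hx) * (evalAt (derivative Q) x).conjTranspose)
    have e3 := congr(evalAt P x * $(h2 x hx) * (evalAt Q x).conjTranspose)
    rw [hT P x, hT Q x]
    generalize A₀ + x • A₁ = F at *
    generalize evalAt (derivative (derivative P)) x = p2 at *
    generalize evalAt (derivative (derivative Q)) x = q2 at *
    generalize evalAt (derivative P) x = p1 at *
    generalize evalAt (derivative Q) x = q1 at *
    generalize evalAt P x = p0 at *
    generalize evalAt Q x = q0 at *
    generalize weight L x = w at *
    generalize dW x = w' at *
    simp only [Matrix.conjTranspose_add, Matrix.conjTranspose_mul, Matrix.conjTranspose_smul,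
      star_trivial, mul_add, add_mul, mul_sub, sub_mul, smul_mul_assoc, mul_smul_comm, mul_assoc,
      smul_add, smul_sub, zero_smul] at e1 e2 e3 ⊢
    linear_combination (norm := module) e1 - e2 + (1 / 2 : ℝ) • e3
  ext i j
  have hint : ∀ P Q : MatPoly L, IntervalIntegrable
      (fun x => (evalAt P x * weight L x * (evalAt Q x).conjTranspose) i j)
      MeasureTheory.volume (-1) 1 :=
    fun P Q => ((continuous_inner_integrand P Q).matrix_elem i j).intervalIntegrable _ _
  -- Differentiability is only needed inside the interval, where √(1-x²) is smooth; at the endpoints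
  -- continuity of `f` suffices.
  have hftc := intervalIntegral.integral_eq_sub_of_hasDerivAt_of_le (by norm_num : (-1 : ℝ) ≤ 1)
    (hfc.matrix_elem i j).continuousOn (fun x hx => hderiv x hx i j)
    ((hint (T.act P) Q).sub (hint P (T.act Q)))
  have hf1 : f 1 = 0 := by simp [hf, weight_eq_zero]
  have hf2 : f (-1) = 0 := by simp [hf, weight_eq_zero]
  rw [hf1, hf2] at hftc
  simp only [Matrix.sub_apply] at hftc
  rw [intervalIntegral.integral_sub (hint _ _) (hint _ _)] at hftc
  simp only [innerW, Matrix.of_apply]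
  rw [← sub_eq_zero, hftc]
  simp

/-! ### Differential equations for the entries of the weight -/

/-- The entry `(n, m)` of the weight. -/
def wval (L n m : ℕ) (x : ℝ) : ℝ := wsin L n m (Real.arccos x)

/-- The derivative of the entry `(n, m)` of the weight. -/
def wderiv (L n m : ℕ) (x : ℝ) : ℝ := -(wcos L n m (Real.arccos x)) / √(1 - x ^ 2)

section Entries

variable {L n m : ℕ} {x : ℝ}

theorem sqrt_one_sub_sq_pos (hx : x ∈ Set.Ioo (-1 : ℝ) 1) : 0 < √(1 - x ^ 2) :=
  Real.sqrt_pos.2 (by nlinarith [hx.1, hx.2])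

theorem wcos_arccos (hx : x ∈ Set.Ioo (-1 : ℝ) 1) (n m : ℕ) :
    wcos L n m (Real.arccos x) = -(√(1 - x ^ 2) * wderiv L n m x) := by
  have := (sqrt_one_sub_sq_pos hx).ne'
  rw [wderiv]
  field_simp

theorem hasDerivAt_wval (hx : x ∈ Set.Ioo (-1 : ℝ) 1) :
    HasDerivAt (wval L n m) (wderiv L n m x) x := by
  have h := (hasDerivAt_wsin L n m (Real.arccos x)).comp x
    (Real.hasDerivAt_arccos hx.1.ne' hx.2.ne)
  refine h.congr_deriv ?_
  rw [wderiv]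
  ring

theorem wderiv_lower (hn : n ≤ L) (hm : m ≤ L) (hx : x ∈ Set.Ioo (-1 : ℝ) 1) :
    (1 - x ^ 2) * wderiv L n m x + x * wval L n m x
      = n * wval L (n - 1) m x + m * wval L n (m - 1) x - (n + m) * (x * wval L n m x) := by
  have h := sin_mul_wcos_lower hn hm (Real.arccos x)
  have hs : √(1 - x ^ 2) * √(1 - x ^ 2) = 1 - x ^ 2 :=
    Real.mul_self_sqrt (by nlinarith [hx.1, hx.2])
  rw [Real.sin_arccos, Real.cos_arccos hx.1.le hx.2.le, wcos_arccos hx] at h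
  simp only [wval]
  linear_combination h - wderiv L n m x * hs

theorem wderiv_raise (hn : n ≤ L) (hm : m ≤ L) (hx : x ∈ Set.Ioo (-1 : ℝ) 1) :
    (1 - x ^ 2) * wderiv L n m x + x * wval L n m x
      = (L - n) * wval L (n + 1) m x + (L - m) * wval L n (m + 1) x
        - (2 * L - n - m) * (x * wval L n m x) := by
  have h := sin_mul_wcos_raise hn hm (Real.arccos x)
  have hs : √(1 - x ^ 2) * √(1 - x ^ 2) = 1 - x ^ 2 :=
    Real.mul_self_sqrt (by nlinarith [hx.1, hx.2])
  rw [Real.sin_arccos, Real.cos_arccos hx.1.le hx.2.le, wcos_arccos hx] at h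
  simp only [wval]
  linear_combination h - wderiv L n m x * hs

theorem wderiv_lower_sub (hn : n ≤ L) (hm : m ≤ L) (hx : x ∈ Set.Ioo (-1 : ℝ) 1) :
    n * wderiv L (n - 1) m x - m * wderiv L n (m - 1) x
        - (n - m) * (wval L n m x + x * wderiv L n m x)
      = -((n - m) * (n + m + 2) * wval L n m x) := by
  have h := wcos_lower_sub hn hm (Real.arccos x)
  rw [Real.sin_arccos, Real.cos_arccos hx.1.le hx.2.le, wcos_arccos hx, wcos_arccos hx,
    wcos_arccos hx] at h
  simp only [wval]
  refine mul_left_cancel₀ (sqrt_one_sub_sq_pos hx).ne' ?_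
  linear_combination -h

theorem wderiv_raise_sub (hn : n ≤ L) (hm : m ≤ L) (hx : x ∈ Set.Ioo (-1 : ℝ) 1) :
    (L - n) * wderiv L (n + 1) m x - (L - m) * wderiv L n (m + 1) x
        + (n - m) * (wval L n m x + x * wderiv L n m x)
      = (n - m) * (2 * L + 2 - n - m) * wval L n m x := by
  have h := wcos_raise_sub hn hm (Real.arccos x)
  rw [Real.sin_arccos, Real.cos_arccos hx.1.le hx.2.le, wcos_arccos hx, wcos_arccos hx,
    wcos_arccos hx] at h
  simp only [wval]
  refine mul_left_cancel₀ (sqrt_one_sub_sq_pos hx).ne' ?_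
  linear_combination -h

end Entries

/-! ### Tridiagonal matrices -/

section Tridiagonal

variable {L : ℕ} {c : ℕ → ℂ}

/-- The matrix `∑ᵢ cᵢ E_{i,i+1}`. -/
def upMat (L : ℕ) (c : ℕ → ℂ) : Mat L := ∑ i ∈ Finset.range (L + 1), c i • matUnit L i (i + 1)

/-- The matrix `∑ᵢ cᵢ E_{i,i-1}`. -/
def downMat (L : ℕ) (c : ℕ → ℂ) : Mat L := ∑ i ∈ Finset.range (L + 1), c i • matUnit L i (i - 1)

/-- The matrix `∑ᵢ cᵢ E_{i,i}`. -/
def diagMat (L : ℕ) (c : ℕ → ℂ) : Mat L := ∑ i ∈ Finset.range (L + 1), c i • matUnit L i i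

/-- The matrix with the entries `f i j`. -/
def ofNat (L : ℕ) (f : ℕ → ℕ → ℂ) : Mat L := Matrix.of fun i j => f i j

theorem upMat_apply (i j : Fin (L + 1)) :
    upMat L c i j = if (j : ℕ) = i + 1 then c i else 0 := by
  rw [upMat, Matrix.sum_apply, Finset.sum_eq_single (i : ℕ)]
  · simp only [matUnit, Matrix.smul_apply, Matrix.of_apply, smul_eq_mul, mul_ite, mul_one, mul_zero,
      true_and]
    norm_cast
  · intro k _ hk
    simp [matUnit, hk.symm]
  · intro h
    exact absurd (Finset.mem_range.2 i.is_lt) h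

theorem downMat_apply (i j : Fin (L + 1)) :
    downMat L c i j = if (j : ℕ) + 1 = i then c i else 0 := by
  rw [downMat, Matrix.sum_apply, Finset.sum_eq_single (i : ℕ)]
  · simp only [matUnit, Matrix.smul_apply, Matrix.of_apply, smul_eq_mul, mul_ite, mul_one, mul_zero,
      true_and]
    simp only [eq_sub_iff_add_eq]
    norm_cast
  · intro k _ hk
    simp [matUnit, hk.symm]
  · intro h
    exact absurd (Finset.mem_range.2 i.is_lt) h

theorem diagMat_eq : diagMat L c = Matrix.diagonal fun i : Fin (L + 1) => c i := by
  ext i j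
  rw [diagMat, Matrix.sum_apply, Finset.sum_eq_single (i : ℕ)]
  · simp only [matUnit, Matrix.smul_apply, Matrix.of_apply, smul_eq_mul, mul_ite, mul_one, mul_zero,
      true_and, Matrix.diagonal_apply]
    norm_cast
    simp only [Fin.ext_iff, eq_comm]
  · intro k _ hk
    simp [matUnit, hk.symm]
  · intro h
    exact absurd (Finset.mem_range.2 i.is_lt) h

/-- In the last row the matrix unit is zero whereas `f (L + 1) j` need not be, so `c L = 0` is what
makes the formula uniform. In `downMat_mul_apply`, `c 0 = 0` does the same for the truncated `i -
1`. -/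
theorem upMat_mul_apply (hc : c L = 0) (f : ℕ → ℕ → ℂ) (i j : Fin (L + 1)) :
    (upMat L c * ofNat L f) i j = c i * f (i + 1) j := by
  simp only [Matrix.mul_apply, upMat_apply, ofNat, Matrix.of_apply, ite_mul, zero_mul]
  rcases i.is_le.lt_or_eq with h | h
  · rw [Finset.sum_eq_single ⟨i + 1, by omega⟩] <;> simp [Fin.ext_iff]
    intro b hb hb'
    exact absurd hb' hb
  · rw [h, hc]
    simp

theorem downMat_mul_apply (hc : c 0 = 0) (f : ℕ → ℕ → ℂ) (i j : Fin (L + 1)) :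
    (downMat L c * ofNat L f) i j = c i * f (i - 1) j := by
  simp only [Matrix.mul_apply, downMat_apply, ofNat, Matrix.of_apply, ite_mul, zero_mul]
  rcases Nat.eq_zero_or_pos (i : ℕ) with h | h
  · rw [h, hc]
    simp
  · rw [Finset.sum_eq_single ⟨i - 1, by omega⟩]
    · simp only
      rw [if_pos (by omega)]
    · intro b _ hb
      rw [if_neg]
      simp only [ne_eq, Fin.ext_iff] at hb
      omega
    · simp

theorem diagMat_mul_apply (f : ℕ → ℕ → ℂ) (i j : Fin (L + 1)) :
    (diagMat L c * ofNat L f) i j = c i * f i j := by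
  rw [diagMat_eq, Matrix.diagonal_mul, ofNat, Matrix.of_apply]

/-- Taking adjoints reduces right multiplication by `M.conjTranspose` to the entry formulas for left
multiplication by `M`. -/
theorem mul_conjTranspose_apply (M : Mat L) (f : ℕ → ℕ → ℂ) (i j : Fin (L + 1)) :
    (ofNat L f * M.conjTranspose) i j = star ((M * ofNat L fun a b => star (f b a)) j i) := by
  have : ofNat L f * M.conjTranspose
      = (M * ofNat L fun a b => star (f b a)).conjTranspose := by
    rw [Matrix.conjTranspose_mul]
    congr 1
    ext a b
    simp [ofNat]
  rw [this, Matrix.conjTranspose_apply]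

end Tridiagonal

/-! ### Pearson equations for the weight -/

section Pearson

variable {L : ℕ} {x : ℝ}

theorem two_mul_ell (L : ℕ) : 2 * ell L = L := by rw [ell]; ring

theorem weight_eq_ofNat (hx : x ∈ Set.Icc (-1 : ℝ) 1) :
    weight L x = ofNat L fun n m => (wval L n m x : ℂ) := by
  ext i j
  exact weight_apply_eq_wsin hx i j

/-- The derivative of the weight. -/
def weightDeriv (L : ℕ) (x : ℝ) : Mat L := ofNat L fun n m => (wderiv L n m x : ℂ)

theorem hasEntryDerivAt_weight (hx : x ∈ Set.Ioo (-1 : ℝ) 1) :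
    HasEntryDerivAt (weight L) (weightDeriv L x) x := by
  intro i j
  refine (hasDerivAt_wval (L := L) (n := i) (m := j) hx).ofReal_comp.congr_of_eventuallyEq ?_
  filter_upwards [Ioo_mem_nhds hx.1 hx.2] with y hy
  exact weight_apply_eq_wsin ⟨hy.1.le, hy.2.le⟩ i j

theorem matC_eq : matC L = upMat L (fun i => (L : ℂ) - i) + downMat L (fun i => (i : ℂ)) := by
  simp only [matC, upMat, downMat, two_mul_ell]

theorem matV_eq : matV L = -diagMat L fun i => (i : ℂ) * (L - i) := by
  simp only [matV, diagMat, two_mul_ell]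

theorem matU_eq : matU L = diagMat L fun _ => (L : ℂ) + 3 := by
  rw [matU, two_mul_ell, diagMat_eq, Matrix.smul_one_eq_diagonal]

theorem matB0_eq : matB0 L = -upMat L (fun i => ((L : ℂ) - i) / (2 * L))
    + downMat L (fun i => (i : ℂ) / (2 * L)) := by
  have : 4 * ell L = 2 * L := by rw [ell]; ring
  simp only [matB0, upMat, downMat, two_mul_ell, this]

theorem matB1_eq : matB1 L = diagMat L fun i => ((L : ℂ) - 2 * i) / (2 * L) := by
  simp only [matB1, diagMat, two_mul_ell]
  refine Finset.sum_congr rfl fun i _ => ?_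
  congr 1
  rcases eq_or_ne L 0 with rfl | hL
  · simp
  · have : (L : ℂ) ≠ 0 := by exact_mod_cast hL
    rw [ell]
    field_simp

theorem matA_eq : matA L = diagMat L fun i => -(((L : ℂ) + 2) * (i - L) / (2 * L)) := by
  have : -4 * ell L = -(2 * L) := by rw [ell]; ring
  simp only [matA, diagMat, two_mul_ell, this, div_neg]

theorem matC_mul_apply (f : ℕ → ℕ → ℂ) (i j : Fin (L + 1)) :
    (matC L * ofNat L f) i j = (L - i) * f (i + 1) j + i * f (i - 1) j := by
  rw [matC_eq, add_mul, Matrix.add_apply, upMat_mul_apply (by simp), downMat_mul_apply (by simp)]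

theorem matB0_mul_apply (f : ℕ → ℕ → ℂ) (i j : Fin (L + 1)) :
    (matB0 L * ofNat L f) i j
      = -((L - i) / (2 * L) * f (i + 1) j) + i / (2 * L) * f (i - 1) j := by
  rw [matB0_eq, add_mul, neg_mul, Matrix.add_apply, Matrix.neg_apply, upMat_mul_apply (by simp),
    downMat_mul_apply (by simp)]

theorem matB1_mul_apply (f : ℕ → ℕ → ℂ) (i j : Fin (L + 1)) :
    (matB1 L * ofNat L f) i j = (L - 2 * i) / (2 * L) * f i j := by
  rw [matB1_eq, diagMat_mul_apply]

theorem matA_mul_apply (f : ℕ → ℕ → ℂ) (i j : Fin (L + 1)) :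
    (matA L * ofNat L f) i j = -((L + 2) * (i - L) / (2 * L)) * f i j := by
  rw [matA_eq, diagMat_mul_apply]

theorem matU_mul_apply (f : ℕ → ℕ → ℂ) (i j : Fin (L + 1)) :
    (matU L * ofNat L f) i j = (L + 3) * f i j := by
  rw [matU_eq, diagMat_mul_apply]

theorem matV_mul_apply (f : ℕ → ℕ → ℂ) (i j : Fin (L + 1)) :
    (matV L * ofNat L f) i j = -(i * (L - i) * f i j) := by
  rw [matV_eq, neg_mul, Matrix.neg_apply, diagMat_mul_apply]

/-- The first Pearson equation is half the sum of the lowering and raising formulas. The second is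
the sum of their antisymmetric versions, in which the (xW)' terms cancel. -/
theorem isSymmetric_opD (L : ℕ) : (opD L).IsSymmetric := by
  refine isSymmetric_of_pearson (dW := weightDeriv L) (φ := fun x => 1 - x ^ 2)
    (φ' := fun x => -(2 * x)) (A₀ := matC L) (A₁ := -matU L) (F₀ := -matV L)
    (fun x => ?_) (fun P x => ?_) (fun x hx => hasEntryDerivAt_weight hx)
    (fun x hx => ?_) (fun x hx => ?_)
  · simpa using (hasDerivAt_pow 2 x).const_sub 1
  · rw [evalAt_opD, smul_neg, ← sub_eq_add_neg, mul_neg, ← sub_eq_add_neg]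
  · rw [weight_eq_ofNat ⟨hx.1.le, hx.2.le⟩, weightDeriv]
    ext i j
    have e1 := congrArg (fun r : ℝ => (r : ℂ)) (wderiv_lower i.is_le j.is_le hx)
    have e2 := congrArg (fun r : ℝ => (r : ℂ)) (wderiv_raise i.is_le j.is_le hx)
    push_cast at e1 e2
    simp only [smul_neg, add_mul, neg_mul, Matrix.conjTranspose_add, Matrix.conjTranspose_neg,
      Matrix.conjTranspose_smul, mul_add, mul_neg, mul_smul_comm, smul_mul_assoc, star_trivial,
      Matrix.add_apply, Matrix.neg_apply, Matrix.smul_apply, mul_conjTranspose_apply,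
      matC_mul_apply, matU_mul_apply]
    simp only [ofNat, Matrix.of_apply, Complex.real_smul, star_add, star_mul', star_sub,
      RCLike.star_def, Complex.conj_ofReal, Complex.conj_natCast,
      map_ofNat, Complex.ofReal_div, Complex.ofReal_one, Complex.ofReal_ofNat, Complex.ofReal_sub,
      Complex.ofReal_pow, Complex.ofReal_neg, Complex.ofReal_mul]
    linear_combination (1 / 2 : ℂ) * e1 + (1 / 2 : ℂ) * e2
  · rw [weight_eq_ofNat ⟨hx.1.le, hx.2.le⟩, weightDeriv]
    ext i j
    have e1 := congrArg (fun r : ℝ => (r : ℂ)) (wderiv_lower_sub i.is_le j.is_le hx)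
    have e2 := congrArg (fun r : ℝ => (r : ℂ)) (wderiv_raise_sub i.is_le j.is_le hx)
    push_cast at e1 e2
    simp only [smul_neg, add_mul, neg_mul, Matrix.conjTranspose_add, Matrix.conjTranspose_neg,
      Matrix.conjTranspose_smul, mul_add, mul_neg, mul_smul_comm, smul_mul_assoc, star_trivial,
      Matrix.add_apply, Matrix.sub_apply, Matrix.neg_apply, Matrix.smul_apply,
      mul_conjTranspose_apply, matC_mul_apply, matU_mul_apply, matV_mul_apply]
    simp only [star_neg, star_add, star_mul', star_sub,
      RCLike.star_def, Complex.conj_ofReal, Complex.conj_natCast,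
      map_ofNat, Complex.real_smul, Complex.ofReal_ofNat]
    linear_combination e1 + e2

/-- Here φ = 0, and both Pearson equations are differences, lowering minus raising, after clearing
the denominator in `L`. -/
theorem isSymmetric_opE {L : ℕ} (hL : 0 < L) : (opE L).IsSymmetric := by
  have hL' : (L : ℂ) ≠ 0 := by exact_mod_cast hL.ne'
  refine isSymmetric_of_pearson (dW := weightDeriv L) (φ := fun _ => 0)
    (φ' := fun _ => 0) (A₀ := matB0 L) (A₁ := matB1 L) (F₀ := matA L)
    (fun x => hasDerivAt_const x 0) (fun P x => ?_) (fun x hx => hasEntryDerivAt_weight hx)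
    (fun x hx => ?_) (fun x hx => ?_)
  · rw [evalAt_opE, zero_smul, zero_add]
  · rw [weight_eq_ofNat ⟨hx.1.le, hx.2.le⟩, weightDeriv]
    ext i j
    have e1 := congrArg (fun r : ℝ => (r : ℂ)) (wderiv_lower i.is_le j.is_le hx)
    have e2 := congrArg (fun r : ℝ => (r : ℂ)) (wderiv_raise i.is_le j.is_le hx)
    push_cast at e1 e2
    simp only [add_mul, Matrix.conjTranspose_add,
      Matrix.conjTranspose_smul, mul_add, mul_smul_comm, smul_mul_assoc, star_trivial,
      Matrix.add_apply, Matrix.smul_apply, mul_conjTranspose_apply,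
      matB0_mul_apply, matB1_mul_apply, zero_smul]
    simp only [Complex.real_smul, star_add, star_mul', star_sub, star_neg, star_div₀,
      RCLike.star_def, Complex.conj_ofReal, Complex.conj_natCast,
      map_ofNat, Complex.ofReal_div, Complex.ofReal_one, Complex.ofReal_ofNat]
    simp only [Matrix.zero_apply, add_zero]
    field_simp
    linear_combination e1 - e2
  · rw [weight_eq_ofNat ⟨hx.1.le, hx.2.le⟩, weightDeriv]
    ext i j
    have e1 := congrArg (fun r : ℝ => (r : ℂ)) (wderiv_lower_sub i.is_le j.is_le hx)
    have e2 := congrArg (fun r : ℝ => (r : ℂ)) (wderiv_raise_sub i.is_le j.is_le hx)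
    push_cast at e1 e2
    simp only [add_mul, Matrix.conjTranspose_add,
      Matrix.conjTranspose_smul, mul_add, mul_smul_comm, smul_mul_assoc, star_trivial,
      Matrix.add_apply, Matrix.sub_apply, Matrix.smul_apply, mul_conjTranspose_apply,
      matB0_mul_apply, matB1_mul_apply, matA_mul_apply]
    simp only [Complex.real_smul, star_add, star_mul', star_sub, star_neg, star_div₀,
      RCLike.star_def, Complex.conj_ofReal, Complex.conj_natCast,
      map_ofNat, Complex.ofReal_ofNat]
    field_simp
    linear_combination e1 - e2

end Pearson

/-! ### Factorization and positivity of the weight -/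

/-- The polynomial `(z + y)ⁿ (1 + z y)^{L - n}` in `y`. -/
def kernelPoly (L : ℕ) (z : ℂ) (n : ℕ) : ℂ[X] := (C z + X) ^ n * (1 + C z * X) ^ (L - n)

/-- Writing p_n for the kernel polynomial, take its logarithmic derivative: z·p_{n-1} - p_n = (z²-1)
y/(z+y)·p_n and z·p_n - p_{n+1} = (z²-1) y/(1+zy)·p_n. So the Euler operator y d/dy, times z² - 1,
is tridiagonal in `n`. -/
theorem X_mul_derivative_kernelPoly {L n : ℕ} (hn : n ≤ L) (z : ℂ) :
    C (z ^ 2 - 1) * (X * derivative (kernelPoly L z n))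
      = C (n : ℂ) * (C z * kernelPoly L z (n - 1) - kernelPoly L z n)
        + C ((L : ℂ) - n) * (C z * (C z * kernelPoly L z n - kernelPoly L z (n + 1))) := by
  obtain ⟨d, rfl⟩ := Nat.exists_eq_add_of_le hn
  have e1 : ((n + d : ℕ) : ℂ) - n = d := by push_cast; ring
  have e2 : n + d - (n + 1) = d - 1 := by omega
  simp only [kernelPoly, e1, e2, Nat.add_sub_cancel_left, derivative_mul, derivative_pow,
    derivative_add, derivative_C, derivative_X, derivative_one, map_sub, map_pow, map_one]
  rcases n with _ | n
  · rcases d with _ | d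
    · simp
    · simp
      ring
  · have e3 : n + 1 + d - n = d + 1 := by omega
    rcases d with _ | d
    · simp
      ring
    · simp [show n + 1 + (d + 1) - n = d + 2 by omega]
      ring

theorem coeff_kernelPoly {L n : ℕ} (hn : n ≤ L) (z : ℂ) (j : ℕ) :
    (z ^ 2 - 1) * (j * (kernelPoly L z n).coeff j)
      = n * (z * (kernelPoly L z (n - 1)).coeff j - (kernelPoly L z n).coeff j)
        + (L - n) * (z * (z * (kernelPoly L z n).coeff j - (kernelPoly L z (n + 1)).coeff j)) := by
  have h := congrArg (fun p => coeff p j) (X_mul_derivative_kernelPoly hn z)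
  have hX : (X * derivative (kernelPoly L z n)).coeff j = j * (kernelPoly L z n).coeff j := by
    cases j with
    | zero => simp
    | succ j => rw [coeff_X_mul, coeff_derivative]; push_cast; ring
  simpa only [coeff_add, coeff_sub, coeff_C_mul, hX] using h

theorem natDegree_kernelPoly_le {L n : ℕ} (hn : n ≤ L) (z : ℂ) :
    (kernelPoly L z n).natDegree ≤ L := by
  have h1 : (C z + X : ℂ[X]).natDegree ≤ 1 := by compute_degree
  have h2 : (1 + C z * X : ℂ[X]).natDegree ≤ 1 := by compute_degree
  calc _ ≤ n * 1 + (L - n) * 1 :=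
        natDegree_mul_le_of_le (natDegree_pow_le_of_le n h1) (natDegree_pow_le_of_le _ h2)
    _ = L := by omega

/-- The entry `(n, m)` of the Gram matrix of the polynomials `kernelPoly`. -/
def gram (L : ℕ) (z : ℂ) (n m : ℕ) : ℂ :=
  ∑ j ∈ Finset.range (L + 1), ((L.choose j : ℂ) ^ 2)⁻¹ *
    ((kernelPoly L z n).coeff j * star ((kernelPoly L z m).coeff j))

/-- The Euler operator has real eigenvalues `j` on the orthogonal basis yʲ, hence is self-adjoint;
times z - z̄ it is skew-adjoint. Moving it from one argument of the form to the other gives the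
recurrence. -/
theorem gram_recurrence {L n m : ℕ} (hn : n ≤ L) (hm : m ≤ L) {z : ℂ} (hz : z * star z = 1) :
    n * gram L z (n - 1) m - (L - n) * gram L z (n + 1) m + m * gram L z n (m - 1)
      - (L - m) * gram L z n (m + 1) + (L - n - m) * ((z + star z) * gram L z n m) = 0 := by
  simp only [gram, Finset.mul_sum]
  rw [← Finset.sum_sub_distrib, ← Finset.sum_add_distrib, ← Finset.sum_sub_distrib,
    ← Finset.sum_add_distrib]
  refine Finset.sum_eq_zero fun j _ => ?_
  have h1 := coeff_kernelPoly hn z j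
  have h2 := congrArg star (coeff_kernelPoly hm z j)
  simp only [star_mul', star_sub, star_add, star_pow, star_one, star_natCast] at h2
  generalize (kernelPoly L z n).coeff j = a at *
  generalize (kernelPoly L z (n - 1)).coeff j = a₁ at *
  generalize (kernelPoly L z (n + 1)).coeff j = a₂ at *
  generalize star ((kernelPoly L z m).coeff j) = b at *
  generalize star ((kernelPoly L z (m - 1)).coeff j) = b₁ at *
  generalize star ((kernelPoly L z (m + 1)).coeff j) = b₂ at *
  generalize star z = w at *
  generalize ((L.choose j : ℂ) ^ 2)⁻¹ = s at *
  -- Multiplying by w = z̄ turns z² - 1 into z - w, which is odd under conjugation.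
  have h1' : (z - w) * (j * a) = n * (a₁ - w * a) + (L - n) * (z * a - a₂) := by
    linear_combination w * h1 + (-(z * j * a) + n * a₁ + (L - n) * (z * a - a₂)) * hz
  have h2' : (w - z) * (j * b) = m * (b₁ - z * b) + (L - m) * (w * b - b₂) := by
    linear_combination z * h2 + (-(w * j * b) + m * b₁ + (L - m) * (w * b - b₂)) * hz
  linear_combination -s * b * h1' - s * a * h2'

/-! ### First column of the Gram matrix, by beta integrals -/

/-- The functional sending `yʲ` to `wʲ` times the beta integral `∫₀¹ tʲ (1 - t)^{L - j} dt`. -/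
def betaSum (L : ℕ) (w : ℂ) (p : ℂ[X]) : ℂ :=
  ∑ j ∈ Finset.range (L + 1),
    ((j.factorial * (L - j).factorial : ℕ) : ℂ) / (L + 1).factorial * w ^ j * p.coeff j

theorem beta_add_beta {L j : ℕ} (hj : j ≤ L) :
    ((j.factorial * (L + 1 - j).factorial : ℕ) : ℂ) / (L + 1 + 1).factorial
      + (((j + 1).factorial * (L + 1 - (j + 1)).factorial : ℕ) : ℂ) / (L + 1 + 1).factorial
      = ((j.factorial * (L - j).factorial : ℕ) : ℂ) / (L + 1).factorial := by
  obtain ⟨r, rfl⟩ := Nat.exists_eq_add_of_le hj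
  rw [show j + r + 1 - j = r + 1 by omega, show j + r + 1 - (j + 1) = r by omega,
    Nat.add_sub_cancel_left, Nat.factorial_succ (j + r + 1), Nat.factorial_succ r,
    Nat.factorial_succ j]
  have h1 : ((j + r + 1).factorial : ℂ) ≠ 0 := by exact_mod_cast Nat.factorial_ne_zero _
  have h2 : (j : ℂ) + r + 1 + 1 ≠ 0 := by
    exact_mod_cast Nat.succ_ne_zero (j + r + 1)
  push_cast
  field_simp
  ring

/-- The functional is ∫₀¹ (1-t)^L p(wt/(1-t)) dt. At that argument 1 + zy = 1/(1-t) because zw = 1,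
which cancels the extra factor 1 - t. On coefficients this is `beta_add_beta`. -/
theorem betaSum_mul {L : ℕ} {z w : ℂ} (hz : z * w = 1) {p : ℂ[X]} (hp : p.natDegree ≤ L) :
    betaSum (L + 1) w (p * (1 + C z * X)) = betaSum L w p := by
  have hc : ∀ j, (p * (1 + C z * X)).coeff (j + 1) = p.coeff (j + 1) + z * p.coeff j := by
    intro j
    rw [mul_add, mul_one, coeff_add, ← mul_assoc, coeff_mul_X, mul_comm p, coeff_C_mul]
  have h0 : (p * (1 + C z * X)).coeff 0 = p.coeff 0 := by simp
  have hlast : p.coeff (L + 1) = 0 := coeff_eq_zero_of_natDegree_lt (by omega)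
  have hsplit : betaSum (L + 1) w (p * (1 + C z * X))
      = betaSum (L + 1) w p + ∑ j ∈ Finset.range (L + 1),
        (((j + 1).factorial * (L + 1 - (j + 1)).factorial : ℕ) : ℂ) / (L + 1 + 1).factorial
          * w ^ j * p.coeff j := by
    have key : ∑ j ∈ Finset.range (L + 1),
          (((j + 1).factorial * (L + 1 - (j + 1)).factorial : ℕ) : ℂ) / (L + 1 + 1).factorial
            * w ^ (j + 1) * (p * (1 + C z * X)).coeff (j + 1)
        = ∑ j ∈ Finset.range (L + 1),
          (((j + 1).factorial * (L + 1 - (j + 1)).factorial : ℕ) : ℂ) / (L + 1 + 1).factorial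
            * w ^ (j + 1) * p.coeff (j + 1)
        + ∑ j ∈ Finset.range (L + 1),
          (((j + 1).factorial * (L + 1 - (j + 1)).factorial : ℕ) : ℂ) / (L + 1 + 1).factorial
            * w ^ j * p.coeff j := by
      rw [← Finset.sum_add_distrib]
      refine Finset.sum_congr rfl fun j _ => ?_
      rw [hc, pow_succ]
      linear_combination (((j + 1).factorial * (L + 1 - (j + 1)).factorial : ℕ) : ℂ)
        / (L + 1 + 1).factorial * w ^ j * p.coeff j * hz
    simp only [betaSum]
    rw [Finset.sum_range_succ' _ (L + 1), Finset.sum_range_succ' _ (L + 1), h0, key]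
    ring
  rw [hsplit]
  simp only [betaSum]
  rw [Finset.sum_range_succ _ (L + 1), hlast, mul_zero, add_zero, ← Finset.sum_add_distrib]
  refine Finset.sum_congr rfl fun j hj => ?_
  rw [← beta_add_beta (Nat.lt_succ_iff.1 (Finset.mem_range.1 hj))]
  ring

theorem betaSum_kernelPoly (n d : ℕ) {z w : ℂ} (hz : z * w = 1) :
    betaSum (n + d) w (kernelPoly (n + d) z n) = betaSum n w (kernelPoly n z n) := by
  induction d with
  | zero => rfl
  | succ d ih =>
    rw [← ih, ← betaSum_mul hz (natDegree_kernelPoly_le (Nat.le_add_right n d) z)]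
    simp only [kernelPoly, Nat.add_sub_cancel_left, ← add_assoc, pow_succ, mul_assoc,
      show n + d + 1 - n = d + 1 by omega]

/-- This evaluates ∫₀¹ (z(1-t) + wt)ⁿ dt: every term of the binomial expansion has the same beta
weight 1/(n+1), leaving a geometric sum. -/
theorem betaSum_self (n : ℕ) (z w : ℂ) :
    (n + 1) * (z - w) * betaSum n w (kernelPoly n z n) = z ^ (n + 1) - w ^ (n + 1) := by
  rw [← geom_sum₂_mul, mul_assoc, mul_left_comm, mul_comm _ (z - w)]
  congr 1
  rw [betaSum, Finset.mul_sum, ← Finset.sum_range_reflect]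
  refine Finset.sum_congr rfl fun j hj => ?_
  have hj' : j ≤ n := Nat.lt_succ_iff.1 (Finset.mem_range.1 hj)
  have e1 : n + 1 - 1 - j = n - j := by omega
  have e2 : n - (n - j) = j := by omega
  rw [e1, e2, kernelPoly, Nat.sub_self, pow_zero, mul_one, add_comm (C z), coeff_X_add_C_pow, e2,
    Nat.choose_symm hj', Nat.factorial_succ]
  have hch : ((n.choose j : ℂ)) * j.factorial * (n - j).factorial = n.factorial := by
    exact_mod_cast Nat.choose_mul_factorial_mul_factorial hj'
  have h1 : (n.factorial : ℂ) ≠ 0 := by exact_mod_cast Nat.factorial_ne_zero _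
  have h2 : (n : ℂ) + 1 ≠ 0 := by exact_mod_cast Nat.succ_ne_zero n
  push_cast
  field_simp
  linear_combination w ^ (n - j) * z ^ j * hch

theorem coeff_kernelPoly_zero (L : ℕ) (z : ℂ) (j : ℕ) :
    (kernelPoly L z 0).coeff j = L.choose j * z ^ j := by
  have h : kernelPoly L z 0 = ((X + 1) ^ L).comp (C z * X) := by
    simp [kernelPoly, add_comm]
  rw [h, comp_C_mul_X_coeff, coeff_X_add_one_pow]

/-- The coefficients binom(L,j) zʲ of (1+zy)^L cancel one of the two inverse binomials; the
remaining one is L + 1 times a beta integral. -/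
theorem gram_zero_right {L n : ℕ} (hn : n ≤ L) {z : ℂ} (hz : z * star z = 1) :
    (n + 1) * (z - star z) * gram L z n 0 = (L + 1) * (z ^ (n + 1) - star z ^ (n + 1)) := by
  obtain ⟨d, hd⟩ := Nat.exists_eq_add_of_le hn
  rw [← betaSum_self, ← betaSum_kernelPoly n d hz, ← hd, mul_left_comm]
  congr 1
  rw [gram, betaSum, Finset.mul_sum]
  refine Finset.sum_congr rfl fun j hj => ?_
  have hj' : j ≤ L := Nat.lt_succ_iff.1 (Finset.mem_range.1 hj)
  rw [coeff_kernelPoly_zero, star_mul', star_natCast, star_pow, Nat.factorial_succ]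
  have hch : ((L.choose j : ℂ)) * j.factorial * (L - j).factorial = L.factorial := by
    exact_mod_cast Nat.choose_mul_factorial_mul_factorial hj'
  have h1 : (L.factorial : ℂ) ≠ 0 := by exact_mod_cast Nat.factorial_ne_zero _
  have h2 : (L : ℂ) + 1 ≠ 0 := by exact_mod_cast Nat.succ_ne_zero L
  have h3 : (L.choose j : ℂ) ≠ 0 := by exact_mod_cast (Nat.choose_pos hj').ne'
  push_cast
  field_simp
  linear_combination -(kernelPoly L z n).coeff j * star z ^ j * hch

/-- The weight is a multiple of a Gram matrix. -/
theorem wval_eq_gram {L : ℕ} {x : ℝ} (hx : x ∈ Set.Ioo (-1 : ℝ) 1) {m : ℕ} (hm : m ≤ L) :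
    ∀ n ≤ L, (wval L n m x : ℂ)
      = √(1 - x ^ 2) * gram L (Complex.exp (Real.arccos x * Complex.I)) n m := by
  set θ := Real.arccos x with hθ
  set z := Complex.exp (θ * Complex.I) with hz
  have hstar : star z = Complex.exp (-(θ * Complex.I)) := by
    rw [hz, Complex.star_def, ← Complex.exp_conj]
    simp
  have hzz : z * star z = 1 := by rw [hstar, hz, ← Complex.exp_add, add_neg_cancel, Complex.exp_zero]
  have hzx : z + star z = 2 * x := by
    have : (Complex.cos θ : ℂ) = x := by
      rw [← Complex.ofReal_cos, hθ, Real.cos_arccos hx.1.le hx.2.le]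
    rw [hstar, hz, ← this, Complex.cos, neg_mul]
    ring
  -- Eliminating the derivative between the lowering and raising formulas leaves exactly
  -- `gram_recurrence`. For m < L it determines column `m + 1` from columns `m` and `m - 1`.
  have hrec : ∀ n ≤ L, ∀ m ≤ L, (n : ℂ) * wval L (n - 1) m x - (L - n) * wval L (n + 1) m x
      + m * wval L n (m - 1) x - (L - m) * wval L n (m + 1) x
      + (L - n - m) * (2 * x * wval L n m x) = 0 := by
    intro n hn m hm
    have h : (n : ℝ) * wval L (n - 1) m x - (L - n) * wval L (n + 1) m x
        + m * wval L n (m - 1) x - (L - m) * wval L n (m + 1) x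
        + (L - n - m) * (2 * x * wval L n m x) = 0 := by
      linear_combination wderiv_raise hn hm hx - wderiv_lower hn hm hx
    exact_mod_cast h
  induction m using Nat.strong_induction_on with
  | _ m ih =>
  rcases m with _ | m
  · intro n hn
    have hg := gram_zero_right hn hzz
    have hpow : ∀ k : ℕ, z ^ k - star z ^ k = 2 * Complex.I * Complex.sin (k * θ) := by
      intro k
      rw [hstar, hz, ← Complex.exp_nat_mul, ← Complex.exp_nat_mul, Complex.sin]
      rw [show (k : ℂ) * -(θ * Complex.I) = -(k * θ) * Complex.I by ring,
        show (k : ℂ) * (θ * Complex.I) = (k * θ) * Complex.I by ring]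
      linear_combination (Complex.exp (k * θ * Complex.I) - Complex.exp (-(k * θ) * Complex.I))
        * Complex.I_sq
    have h1 := hpow 1
    have hsin : Complex.sin ((1 : ℕ) * θ) = (√(1 - x ^ 2) : ℝ) := by
      rw [Nat.cast_one, one_mul, ← Complex.ofReal_sin, hθ, Real.sin_arccos]
    rw [hsin, pow_one, pow_one] at h1
    rw [hpow, h1] at hg
    have hw : (n + 1) * wval L n 0 x = (L + 1) * Real.sin ((n + 1) * θ) := by
      rw [wval, ← hθ, wsin, Finset.sum_eq_single 0]
      · rw [wcoeff_of_le (Nat.zero_le n) le_rfl, alpha_eq 0 L rfl (by simp)]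
        have := Nat.factorial_ne_zero L
        simp [poch_zero]
        field_simp
      · intro t _ ht
        rw [wcoeff_of_lt_right (by omega), zero_mul]
      · simp
    have hw' : ((n : ℂ) + 1) * wval L n 0 x = (L + 1) * Complex.sin ((n + 1) * θ) := by
      exact_mod_cast congrArg (fun r : ℝ => (r : ℂ)) hw
    have h2 : (n : ℂ) + 1 ≠ 0 := by exact_mod_cast Nat.succ_ne_zero n
    refine mul_left_cancel₀ (mul_ne_zero h2 (mul_ne_zero two_ne_zero Complex.I_ne_zero)) ?_
    push_cast at hg
    linear_combination 2 * Complex.I * hw' - hg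
  · intro n hn
    have hmL : m ≤ L := by omega
    have hg := gram_recurrence hn hmL hzz
    rw [hzx] at hg
    have hw := hrec n hn m hmL
    have i1 := ih m (by omega) hmL n hn
    have i2 : (m : ℂ) * wval L n (m - 1) x = m * (√(1 - x ^ 2) * gram L z n (m - 1)) := by
      rcases Nat.eq_zero_or_pos m with rfl | h
      · simp
      · rw [ih (m - 1) (by omega) (by omega) n hn]
    have i3 : (n : ℂ) * wval L (n - 1) m x = n * (√(1 - x ^ 2) * gram L z (n - 1) m) := by
      rw [ih m (by omega) hmL (n - 1) (by omega)]
    have i4 : ((L : ℂ) - n) * wval L (n + 1) m x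
        = (L - n) * (√(1 - x ^ 2) * gram L z (n + 1) m) := by
      rcases hn.lt_or_eq with h | rfl
      · rw [ih m (by omega) hmL (n + 1) h]
      · simp
    have h0 : (L : ℂ) - m ≠ 0 := by
      rw [sub_ne_zero]
      exact_mod_cast (by omega : L ≠ m)
    refine mul_left_cancel₀ h0 ?_
    linear_combination √(1 - x ^ 2) * hg - hw + i2 + i3 - i4 + (L - n - m) * (2 * x) * i1

/-! ### Independence of the kernel polynomials and positivity -/

/-- The Möbius substitution y = (τ-z)/(1-zτ), invertible when z² ≠ 1, gives z + y = τ(1+zy). It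
sends the kernel polynomials to (1+zy)^L τⁿ, so independence reduces to that of the monomials τⁿ. -/
theorem sum_kernelPoly_ne_zero {L : ℕ} {z : ℂ} (hz : z ^ 2 ≠ 1) {c : Fin (L + 1) → ℂ}
    (hc : c ≠ 0) : ∑ n : Fin (L + 1), C (c n) * kernelPoly L z n ≠ 0 := by
  intro h
  have hz1 : (1 : ℂ) - z ^ 2 ≠ 0 := sub_ne_zero.2 hz.symm
  have hp : (∑ n : Fin (L + 1), C (c n) * X ^ (n : ℕ) : ℂ[X]) = 0 := by
    refine eq_zero_of_infinite_isRoot _ ?_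
    refine (Set.finite_singleton z⁻¹).infinite_compl.mono fun τ hτ => ?_
    have hτ' : 1 - z * τ ≠ 0 := by
      intro h0
      exact hτ (eq_inv_of_mul_eq_one_right (by linear_combination -h0))
    have hv : 1 + z * ((τ - z) / (1 - z * τ)) ≠ 0 := by
      have : 1 + z * ((τ - z) / (1 - z * τ)) = (1 - z ^ 2) / (1 - z * τ) := by
        field_simp
        ring
      rw [this]
      exact div_ne_zero hz1 hτ'
    have hu : z + (τ - z) / (1 - z * τ) = τ * (1 + z * ((τ - z) / (1 - z * τ))) := by
      field_simp
      ring
    have he := congrArg (eval ((τ - z) / (1 - z * τ))) h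
    simp only [eval_finsetSum, kernelPoly, eval_mul, eval_C, eval_pow, eval_add, eval_X, eval_one,
      eval_zero, hu] at he
    simp only [Set.mem_ofPred_eq, IsRoot, eval_finsetSum, eval_mul, eval_C, eval_pow, eval_X]
    refine mul_right_cancel₀ (pow_ne_zero L hv) ?_
    rw [zero_mul, ← he, Finset.sum_mul]
    refine Finset.sum_congr rfl fun n _ => ?_
    rw [← pow_mul_pow_sub _ n.is_le, mul_pow]
    generalize 1 + z * ((τ - z) / (1 - z * τ)) = u
    ring
  refine hc (funext fun n => ?_)
  have := congrArg (fun p => coeff p (n : ℕ)) hp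
  simp only [finsetSum_coeff, coeff_C_mul_X_pow, coeff_zero] at this
  rw [Finset.sum_eq_single n] at this
  · simpa using this
  · intro b _ hb
    rw [if_neg (fun h => hb (Fin.ext h.symm))]
  · simp

theorem dotProduct_weight_pos {L : ℕ} {x : ℝ} (hx : x ∈ Set.Ioo (-1 : ℝ) 1)
    {v : Fin (L + 1) → ℂ} (hv : v ≠ 0) : 0 < star v ⬝ᵥ (weight L x).mulVec v := by
  set z := Complex.exp (Real.arccos x * Complex.I) with hz
  have hz2 : z ^ 2 ≠ 1 := by
    intro h
    have hs : Complex.sin (Real.arccos x) ≠ 0 := by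
      rw [← Complex.ofReal_sin, Real.sin_arccos]
      exact_mod_cast (sqrt_one_sub_sq_pos hx).ne'
    refine hs ?_
    have h1 : z * Complex.exp (-(Real.arccos x * Complex.I)) = 1 := by
      rw [hz, ← Complex.exp_add, add_neg_cancel, Complex.exp_zero]
    have h2 : Complex.exp (-(Real.arccos x * Complex.I)) = z := by
      linear_combination -Complex.exp (-(Real.arccos x * Complex.I)) * h + z * h1
    rw [Complex.sin, neg_mul, h2, ← hz, sub_self, zero_mul, zero_div]
  have hsv : star v ≠ 0 := star_ne_zero.2 hv
  set q : ℂ[X] := ∑ n : Fin (L + 1), C (star v n) * kernelPoly L z n with hq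
  have hexp : star v ⬝ᵥ (weight L x).mulVec v = (√(1 - x ^ 2) : ℂ) *
      ∑ j ∈ Finset.range (L + 1), ((L.choose j : ℂ) ^ 2)⁻¹ * (q.coeff j * star (q.coeff j)) := by
    have hqc : ∀ j, q.coeff j = ∑ n : Fin (L + 1), star v n * (kernelPoly L z n).coeff j := by
      intro j
      simp only [hq, finsetSum_coeff, coeff_C_mul]
    simp only [dotProduct, Matrix.mulVec]
    simp only [weight_apply_eq_wsin ⟨hx.1.le, hx.2.le⟩]
    have hw : ∀ n m : Fin (L + 1), (wsin L n m (Real.arccos x) : ℂ)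
        = √(1 - x ^ 2) * gram L z n m := fun n m => wval_eq_gram hx m.is_le n n.is_le
    simp only [hw, hqc, gram, star_sum, Finset.sum_mul_sum]
    simp only [Finset.mul_sum, Finset.sum_mul]
    symm
    rw [Finset.sum_comm]
    refine Finset.sum_congr rfl fun n _ => ?_
    rw [Finset.sum_comm]
    refine Finset.sum_congr rfl fun m _ => Finset.sum_congr rfl fun j _ => ?_
    rw [star_mul', Pi.star_apply, Pi.star_apply, star_star]
    ring
  have hq0 : q ≠ 0 := sum_kernelPoly_ne_zero hz2 hsv
  have hdeg : q.natDegree ≤ L :=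
    natDegree_sum_le_of_forall_le _ _ fun n _ =>
      (natDegree_C_mul_le _ _).trans (natDegree_kernelPoly_le n.is_le z)
  rw [hexp]
  refine mul_pos (by exact_mod_cast sqrt_one_sub_sq_pos hx) ?_
  -- The quadratic form is a positively weighted sum of |q_j|²; the leading coefficient of `q`
  -- provides a strictly positive term.
  refine Finset.sum_pos' (fun j _ => ?_) ⟨q.natDegree, by simpa [Nat.lt_succ_iff] using hdeg, ?_⟩
  · refine mul_nonneg ?_ (mul_star_self_nonneg _)
    rw [inv_nonneg]
    exact_mod_cast Nat.zero_le _
  · refine mul_pos ?_ ?_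
    · rw [inv_pos]
      exact_mod_cast pow_pos (Nat.choose_pos hdeg) 2
    · rw [Complex.star_def, Complex.mul_conj]
      exact_mod_cast Complex.normSq_pos.2 (leadingCoeff_ne_zero.2 hq0)

variable {L : ℕ}

/-! ### The matrix-valued inner product -/

theorem weight_conjTranspose (L : ℕ) (x : ℝ) : (weight L x).conjTranspose = weight L x := by
  ext i j
  simp only [Matrix.conjTranspose_apply, weight, Matrix.of_apply]
  rcases lt_trichotomy (i : ℕ) j with h | h | h
  · simp [h.le, h.not_ge]
  · simp [h]
  · simp [h.le, h.not_ge]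

theorem intervalIntegrable_inner (P Q : MatPoly L) (i j : Fin (L + 1)) :
    IntervalIntegrable (fun x => (evalAt P x * weight L x * (evalAt Q x).conjTranspose) i j)
      MeasureTheory.volume (-1) 1 :=
  ((continuous_inner_integrand P Q).matrix_elem i j).intervalIntegrable _ _

theorem innerW_conjTranspose (P Q : MatPoly L) : (innerW P Q).conjTranspose = innerW Q P := by
  ext i j
  simp only [Matrix.conjTranspose_apply, innerW, Matrix.of_apply, Complex.star_def]
  rw [← intervalIntegral.intervalIntegral_conj]
  congr 1
  ext x
  rw [← Complex.star_def, ← Matrix.conjTranspose_apply]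
  simp only [Matrix.conjTranspose_mul, Matrix.conjTranspose_conjTranspose, weight_conjTranspose,
    mul_assoc]

theorem innerW_add_left (P Q R : MatPoly L) : innerW (P + Q) R = innerW P R + innerW Q R := by
  ext i j
  simp only [innerW, Matrix.of_apply, Matrix.add_apply, evalAt_add, add_mul]
  exact intervalIntegral.integral_add (intervalIntegrable_inner P R i j)
    (intervalIntegrable_inner Q R i j)

theorem innerW_C_mul_left (A : Mat L) (P Q : MatPoly L) :
    innerW (C A * P) Q = A * innerW P Q := by
  ext i j
  simp only [innerW, Matrix.of_apply, Matrix.mul_apply (M := A), evalAt_mul, evalAt_C, mul_assoc A]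
  rw [intervalIntegral.integral_finsetSum
    fun k _ => (intervalIntegrable_inner P Q k j).const_mul _]
  simp only [intervalIntegral.integral_const_mul]

theorem innerW_zero_left (Q : MatPoly L) : innerW 0 Q = 0 := by
  simpa using innerW_C_mul_left 0 0 Q

theorem innerW_neg_left (P Q : MatPoly L) : innerW (-P) Q = -innerW P Q := by
  have h : -P = C (-1) * P := by
    rw [C_neg, C_1]
    exact (neg_one_mul P).symm
  rw [h, innerW_C_mul_left, neg_one_mul]

theorem innerW_sub_left (P Q R : MatPoly L) : innerW (P - Q) R = innerW P R - innerW Q R := by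
  rw [sub_eq_add_neg, innerW_add_left, innerW_neg_left, sub_eq_add_neg]

theorem innerW_sum_left {ι : Type*} (s : Finset ι) (P : ι → MatPoly L) (Q : MatPoly L) :
    innerW (∑ k ∈ s, P k) Q = ∑ k ∈ s, innerW (P k) Q :=
  map_sum (⟨⟨fun P => innerW P Q, innerW_zero_left Q⟩, fun P R => innerW_add_left P R Q⟩ :
    MatPoly L →+ Mat L) P s

theorem innerW_zero_right (P : MatPoly L) : innerW P 0 = 0 := by
  rw [← innerW_conjTranspose, innerW_zero_left, Matrix.conjTranspose_zero]

theorem innerW_add_right (P Q R : MatPoly L) : innerW P (Q + R) = innerW P Q + innerW P R := by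
  rw [← innerW_conjTranspose, innerW_add_left, Matrix.conjTranspose_add, innerW_conjTranspose,
    innerW_conjTranspose]

theorem innerW_C_mul_right (A : Mat L) (P Q : MatPoly L) :
    innerW P (C A * Q) = innerW P Q * A.conjTranspose := by
  rw [← innerW_conjTranspose, innerW_C_mul_left, Matrix.conjTranspose_mul, innerW_conjTranspose]

theorem innerW_eq_zero_symm {P Q : MatPoly L} (h : innerW P Q = 0) : innerW Q P = 0 := by
  rw [← innerW_conjTranspose, h, Matrix.conjTranspose_zero]

/-! ### Positivity -/

theorem exists_vecMul_evalAt_ne_zero {P : MatPoly L} {v : Fin (L + 1) → ℂ} {k : ℕ}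
    (h : Matrix.vecMul v (P.coeff k) ≠ 0) :
    ∃ x ∈ Set.Ioo (-1 : ℝ) 1, Matrix.vecMul v (evalAt P x) ≠ 0 := by
  by_contra! hall
  obtain ⟨j, hj⟩ := Function.ne_iff.1 h
  set r : ℂ[X] := ∑ i ∈ Finset.range (P.natDegree + 1),
    C (Matrix.vecMul v (P.coeff i) j) * X ^ i with hr
  have hr0 : r = 0 := by
    refine eq_zero_of_infinite_isRoot _ (((Set.Ioo_infinite (by norm_num : (-1 : ℝ) < 1)).image
      Complex.ofReal_injective.injOn).mono ?_)
    rintro _ ⟨x, hx, rfl⟩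
    have hx := congrFun (hall x hx) j
    have he : evalAt P x = ∑ i ∈ Finset.range (P.natDegree + 1), ((x : ℂ) ^ i) • P.coeff i := by
      rw [evalAt, eval_eq_sum_range]
      refine Finset.sum_congr rfl fun i _ => ?_
      rw [← map_pow, Matrix.scalar_apply, ← Matrix.smul_one_eq_diagonal, mul_smul_comm, mul_one]
    rw [he, Matrix.vecMul_sum, Finset.sum_apply] at hx
    simp only [Set.mem_ofPred_eq, IsRoot, hr, eval_finsetSum, eval_mul, eval_C, eval_pow, eval_X]
    refine Eq.trans (Finset.sum_congr rfl fun i _ => ?_) hx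
    rw [Matrix.vecMul_smul, Pi.smul_apply, smul_eq_mul, mul_comm]
  have hk := congrArg (fun p => coeff p k) hr0
  simp only [hr, finsetSum_coeff, coeff_C_mul_X_pow, coeff_zero] at hk
  refine hj ?_
  by_cases hkd : k ≤ P.natDegree
  · rwa [Finset.sum_ite_eq, if_pos (by simpa [Nat.lt_succ_iff] using hkd)] at hk
  · rw [coeff_eq_zero_of_natDegree_lt (by omega), Matrix.vecMul_zero]

/-- The quadratic form is ∫ u*Wu with u(x) = P(x)*v. The integrand is continuous, nonnegative, and
positive wherever u ≠ 0 inside the interval. Only one coefficient not killed by v* is required, so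
singular leading coefficients are covered too. -/
theorem dotProduct_innerW_pos {P : MatPoly L} {v : Fin (L + 1) → ℂ} {k : ℕ}
    (h : Matrix.vecMul (star v) (P.coeff k) ≠ 0) :
    0 < star v ⬝ᵥ (innerW P P).mulVec v := by
  set M : ℝ → Mat L := fun x => evalAt P x * weight L x * (evalAt P x).conjTranspose with hM
  set g : ℝ → ℂ := fun x => star v ⬝ᵥ (M x).mulVec v with hg
  have hMc : Continuous M := continuous_inner_integrand P P
  have hgc : Continuous g := by
    rw [hg]
    simp only [dotProduct, Matrix.mulVec]
    exact continuous_finsetSum _ fun i _ => continuous_const.mul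
      (continuous_finsetSum _ fun j _ => (hMc.matrix_elem i j).mul continuous_const)
  have hint : star v ⬝ᵥ (innerW P P).mulVec v = ∫ x in (-1 : ℝ)..1, g x := by
    simp only [hg, dotProduct, Matrix.mulVec]
    rw [intervalIntegral.integral_finsetSum]
    · refine Finset.sum_congr rfl fun i _ => ?_
      rw [intervalIntegral.integral_const_mul, intervalIntegral.integral_finsetSum]
      · simp only [intervalIntegral.integral_mul_const]
        rfl
      · exact fun j _ => (intervalIntegrable_inner P P i j).mul_const _
    · intro i _
      exact (continuous_const.mul (continuous_finsetSum _ fun j _ =>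
        (hMc.matrix_elem i j).mul continuous_const)).intervalIntegrable _ _
  have hgu : ∀ x, g x = star ((evalAt P x).conjTranspose.mulVec v) ⬝ᵥ
      (weight L x).mulVec ((evalAt P x).conjTranspose.mulVec v) := by
    intro x
    simp only [hg, hM, Matrix.star_mulVec, Matrix.conjTranspose_conjTranspose,
      ← Matrix.mulVec_mulVec, Matrix.dotProduct_mulVec]
  have hpos : ∀ x ∈ Set.Ioo (-1 : ℝ) 1, (evalAt P x).conjTranspose.mulVec v ≠ 0 → 0 < g x :=
    fun x hx hu => by rw [hgu]; exact dotProduct_weight_pos hx hu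
  have hnonneg : ∀ x ∈ Set.Icc (-1 : ℝ) 1, 0 ≤ g x := by
    intro x hx
    by_cases hu : (evalAt P x).conjTranspose.mulVec v = 0
    · rw [hgu, hu]
      simp
    · by_cases hx1 : x ^ 2 = 1
      · rw [hgu, weight_eq_zero hx1]
        simp
      · refine (hpos x ⟨hx.1.lt_of_ne ?_, hx.2.lt_of_ne ?_⟩ hu).le
        · rintro rfl
          exact hx1 (by norm_num)
        · rintro rfl
          exact hx1 (by norm_num)
  have hre : ∫ x in (-1 : ℝ)..1, g x = ((∫ x in (-1 : ℝ)..1, (g x).re : ℝ) : ℂ) := by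
    rw [← intervalIntegral.integral_ofReal]
    refine intervalIntegral.integral_congr fun x hx => ?_
    rw [Set.uIcc_of_le (by norm_num)] at hx
    exact Complex.eq_re_of_ofReal_le (r := 0) (by simpa using hnonneg x hx)
  obtain ⟨c, hc, hcv⟩ := exists_vecMul_evalAt_ne_zero h
  have hcpos : 0 < g c := by
    refine hpos c hc fun h0 => hcv ?_
    rw [← Matrix.conjTranspose_conjTranspose (evalAt P c), ← Matrix.star_mulVec, h0, star_zero]
  rw [hint, hre]
  have : 0 < ∫ x in (-1 : ℝ)..1, (g x).re :=
    intervalIntegral.integral_pos (by norm_num) (Complex.continuous_re.comp hgc).continuousOn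
      (fun x hx => (Complex.le_def.1 (hnonneg x ⟨hx.1.le, hx.2⟩)).1)
      ⟨c, ⟨hc.1.le, hc.2.le⟩, (Complex.lt_def.1 hcpos).1⟩
  exact_mod_cast this

theorem posDef_innerW_of_monic {P : MatPoly L} (hP : P.Monic) : (innerW P P).PosDef := by
  refine Matrix.PosDef.of_dotProduct_mulVec_pos (innerW_conjTranspose P P) fun {v} hv => ?_
  refine dotProduct_innerW_pos (k := P.natDegree) ?_
  rw [hP.coeff_natDegree, Matrix.vecMul_one]
  exact star_ne_zero.2 hv

/-- A nonzero leading coefficient may be singular, but it has a nonzero row; the basis vector of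
that row is the test vector. -/
theorem eq_zero_of_innerW_self {P : MatPoly L} (h : innerW P P = 0) : P = 0 := by
  by_contra hP
  have hl : P.leadingCoeff ≠ 0 := leadingCoeff_ne_zero.2 hP
  obtain ⟨i, hi⟩ : ∃ i, P.leadingCoeff i ≠ 0 := by
    by_contra! h
    exact hl (funext h)
  have hs : star (Pi.single i 1 : Fin (L + 1) → ℂ) = Pi.single i 1 := by
    rw [← Pi.single_star, star_one]
  have := dotProduct_innerW_pos (P := P) (v := Pi.single i 1) (k := P.natDegree) (by
    rw [hs, Matrix.single_one_vecMul]
    exact hi)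
  rw [h] at this
  simp at this

/-! ### Monic orthogonal polynomials -/

theorem degree_sub_C_coeff_mul_lt {P Q : MatPoly L} {N : ℕ} (hP : P.natDegree = N ∧ P.Monic)
    (hQ : Q.degree < (N + 1 : ℕ)) : (Q - C (Q.coeff N) * P).degree < N := by
  rw [degree_lt_iff_coeff_zero] at hQ ⊢
  intro m hm
  rw [coeff_sub, coeff_C_mul]
  rcases hm.eq_or_lt with rfl | h
  · have : P.coeff N = 1 := by rw [← hP.1]; exact hP.2
    rw [this, mul_one, sub_self]
  · rw [hQ m h, coeff_eq_zero_of_natDegree_lt (p := P) (by omega), mul_zero, sub_zero]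

/-- Induction over the left module of matrix polynomials, along a monic sequence. -/
theorem induction_monic {P : ℕ → MatPoly L} (hP : ∀ n, (P n).natDegree = n ∧ (P n).Monic)
    {motive : MatPoly L → Prop} (zero : motive 0)
    (add : ∀ Q R, motive Q → motive R → motive (Q + R)) {N : ℕ}
    (mul : ∀ (A : Mat L), ∀ k < N, motive (C A * P k)) {Q : MatPoly L} (hQ : Q.degree < N) :
    motive Q := by
  induction N generalizing Q with
  | zero =>
    have : Q = 0 := by
      ext1 m
      exact (degree_lt_iff_coeff_zero _ _).1 hQ m (Nat.zero_le m)
    rwa [this]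
  | succ N ih =>
    have h := ih (fun A k hk => mul A k (hk.trans (Nat.lt_succ_self N)))
      (degree_sub_C_coeff_mul_lt (hP N) hQ)
    have := add _ _ h (mul (Q.coeff N) N (Nat.lt_succ_self N))
    rwa [sub_add_cancel] at this

theorem IsMonicOrthogonal.innerW_eq_zero {P : ℕ → MatPoly L} (hP : IsMonicOrthogonal L P)
    {n : ℕ} {Q : MatPoly L} (hQ : Q.degree < n) : innerW (P n) Q = 0 := by
  refine induction_monic hP.1 (motive := fun Q => innerW (P n) Q = 0) (innerW_zero_right _)
    (fun Q R h1 h2 => by rw [innerW_add_right, h1, h2, add_zero]) (fun A k hk => ?_) hQ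
  rw [innerW_C_mul_right, hP.2.1 n k hk.ne', zero_mul]

theorem IsMonicOrthogonal.unique {P Q : ℕ → MatPoly L} (hP : IsMonicOrthogonal L P)
    (hQ : IsMonicOrthogonal L Q) : P = Q := by
  ext1 n
  have hdeg : (P n - Q n).degree < n := by
    rw [degree_lt_iff_coeff_zero]
    intro m hm
    rw [coeff_sub]
    rcases hm.eq_or_lt with rfl | h
    · have h1 : (P n).coeff n = 1 := by
        have := (hP.1 n).2.coeff_natDegree
        rwa [(hP.1 n).1] at this
      have h2 : (Q n).coeff n = 1 := by
        have := (hQ.1 n).2.coeff_natDegree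
        rwa [(hQ.1 n).1] at this
      rw [h1, h2, sub_self]
    · rw [coeff_eq_zero_of_natDegree_lt (by rwa [(hP.1 n).1]),
        coeff_eq_zero_of_natDegree_lt (by rwa [(hQ.1 n).1]), sub_self]
  -- The difference has degree below `n`, so both `P n` and `Q n` are orthogonal to it, and so is
  -- the difference itself.
  refine sub_eq_zero.1 (eq_zero_of_innerW_self ?_)
  rw [innerW_sub_left, hP.innerW_eq_zero hdeg, hQ.innerW_eq_zero hdeg, sub_self]

/-- The Gram–Schmidt process applied to the monomials. -/
def gramSchmidtMonic (L : ℕ) (n : ℕ) : MatPoly L :=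
  X ^ n - ∑ k : Fin n, C (innerW (X ^ n) (gramSchmidtMonic L k) *
    (innerW (gramSchmidtMonic L k) (gramSchmidtMonic L k))⁻¹) * gramSchmidtMonic L k
termination_by n
decreasing_by all_goals exact k.is_lt

theorem gramSchmidtMonic_monic (n : ℕ) :
    (gramSchmidtMonic L n).natDegree = n ∧ (gramSchmidtMonic L n).Monic := by
  induction n using Nat.strong_induction_on with
  | _ n ih =>
  have hdeg : (∑ k : Fin n, C (innerW (X ^ n) (gramSchmidtMonic L k) *
      (innerW (gramSchmidtMonic L k) (gramSchmidtMonic L k))⁻¹) * gramSchmidtMonic L k).degree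
      < n := by
    rw [degree_lt_iff_coeff_zero]
    intro m hm
    rw [finsetSum_coeff]
    refine Finset.sum_eq_zero fun k _ => ?_
    rw [coeff_C_mul, coeff_eq_zero_of_natDegree_lt, mul_zero]
    rw [(ih k k.is_lt).1]
    exact k.is_lt.trans_le hm
  rw [gramSchmidtMonic]
  refine ⟨?_, monic_X_pow_sub hdeg⟩
  refine natDegree_eq_of_degree_eq_some ?_
  rw [degree_sub_eq_left_of_degree_lt (by rwa [degree_X_pow]), degree_X_pow]

theorem isMonicOrthogonal_gramSchmidtMonic (L : ℕ) :
    IsMonicOrthogonal L (gramSchmidtMonic L) := by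
  have hpos := fun n => posDef_innerW_of_monic (gramSchmidtMonic_monic (L := L) n).2
  have hlt : ∀ n, ∀ m < n, innerW (gramSchmidtMonic L n) (gramSchmidtMonic L m) = 0 := by
    intro n
    induction n using Nat.strong_induction_on with
    | _ n ih =>
    intro m hm
    rw [gramSchmidtMonic, innerW_sub_left, innerW_sum_left,
      Finset.sum_eq_single (⟨m, hm⟩ : Fin n)]
    · rw [innerW_C_mul_left, mul_assoc, Matrix.nonsing_inv_mul _
        ((Matrix.isUnit_iff_isUnit_det _).1 (hpos m).isUnit), mul_one,
        sub_self]
    · intro k _ hk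
      rw [innerW_C_mul_left]
      have : innerW (gramSchmidtMonic L k) (gramSchmidtMonic L m) = 0 := by
        rcases lt_or_gt_of_ne (fun h => hk (Fin.ext h) : (k : ℕ) ≠ m) with h | h
        · exact innerW_eq_zero_symm (ih m hm k h)
        · exact ih k k.is_lt m h
      rw [this, mul_zero]
    · simp
  refine ⟨gramSchmidtMonic_monic, fun n m hnm => ?_, hpos⟩
  rcases lt_or_gt_of_ne hnm with h | h
  · exact innerW_eq_zero_symm (hlt m n h)
  · exact hlt n m h

/-! ### Eigenfunctions -/

theorem DiffOp.act_zero {s : ℕ} (T : DiffOp L s) : T.act 0 = 0 := by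
  simp [DiffOp.act]

theorem DiffOp.act_add {s : ℕ} (T : DiffOp L s) (P Q : MatPoly L) :
    T.act (P + Q) = T.act P + T.act Q := by
  simp only [DiffOp.act, iterate_map_add, add_mul, Finset.sum_add_distrib]

theorem DiffOp.act_C_mul {s : ℕ} (T : DiffOp L s) (A : Mat L) (P : MatPoly L) :
    T.act (C A * P) = C A * T.act P := by
  simp only [DiffOp.act, iterate_derivative_C_mul, mul_assoc, Finset.mul_sum]

/-- A symmetric operator which acts on leading coefficients as right multiplication by `Λ` has the
monic orthogonal polynomials as eigenfunctions. -/
theorem IsMonicOrthogonal.act_eq {s : ℕ} {T : DiffOp L s} (hT : T.IsSymmetric) {Λ : ℕ → Mat L}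
    (hΛ : ∀ (n : ℕ) (Q : MatPoly L), (∀ m, n < m → Q.coeff m = 0) →
      (T.act Q).coeff n = Q.coeff n * Λ n)
    {P : ℕ → MatPoly L} (hP : IsMonicOrthogonal L P) (n : ℕ) :
    T.act (P n) = C (Λ n) * P n := by
  have hact : ∀ Q : MatPoly L, Q.degree < n → (T.act Q).degree < n := by
    intro Q hQ
    rw [degree_lt_iff_coeff_zero] at hQ ⊢
    intro m hm
    rw [hΛ m Q fun k hk => hQ k (hm.trans hk.le), hQ m hm, zero_mul]
  have hPn : ∀ m, n < m → (P n).coeff m = 0 := fun m hm =>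
    coeff_eq_zero_of_natDegree_lt (by rwa [(hP.1 n).1])
  have hlead : (P n).coeff n = 1 := by
    have := (hP.1 n).2.coeff_natDegree
    rwa [(hP.1 n).1] at this
  set R := T.act (P n) - C (Λ n) * P n with hR
  have hdeg : R.degree < n := by
    rw [degree_lt_iff_coeff_zero]
    intro m hm
    rw [hR, coeff_sub, coeff_C_mul]
    rcases hm.eq_or_lt with rfl | h
    · rw [hΛ _ _ hPn, hlead, one_mul, mul_one, sub_self]
    · rw [hΛ m _ fun k hk => hPn k (h.trans hk), hPn m h, zero_mul, mul_zero, sub_self]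
  refine sub_eq_zero.1 (eq_zero_of_innerW_self (P := R) ?_)
  -- Symmetry moves `T` onto `R`. Both `R` and `T.act R` have degree below `n`, so both terms vanish
  -- by orthogonality.
  have : innerW R R = innerW (P n) (T.act R) - Λ n * innerW (P n) R := by
    rw [← hT, ← innerW_C_mul_left, ← innerW_sub_left]
  rw [this, hP.innerW_eq_zero hdeg, hP.innerW_eq_zero (hact R hdeg), mul_zero, sub_zero]

/-! ### Action of the operators on coefficients, and commutation -/

theorem coeff_derivative_smul (Q : MatPoly L) (k : ℕ) :
    (derivative Q).coeff k = ((k : ℂ) + 1) • Q.coeff (k + 1) := by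
  rw [coeff_derivative, ← Nat.cast_succ, ← nsmul_eq_mul', ← Nat.cast_smul_eq_nsmul ℂ]
  push_cast
  rfl

theorem coeff_derivative_mul_X (Q : MatPoly L) (k : ℕ) :
    (derivative Q * X).coeff k = (k : ℂ) • Q.coeff k := by
  cases k with
  | zero => simp
  | succ k => rw [coeff_mul_X, coeff_derivative_smul]; push_cast; rfl

theorem coeff_derivative_derivative_mul_X_sq (Q : MatPoly L) (k : ℕ) :
    (derivative (derivative Q) * X ^ 2).coeff k = ((k : ℂ) * (k - 1)) • Q.coeff k := by
  rw [pow_two, ← mul_assoc]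
  cases k with
  | zero => simp
  | succ k =>
    rw [coeff_mul_X, coeff_derivative_mul_X, coeff_derivative_smul, smul_smul]
    congr 1
    push_cast
    ring

theorem coeff_opD_act (Q : MatPoly L) (k : ℕ) :
    ((opD L).act Q).coeff k = (((k : ℂ) + 1) * (k + 2)) • Q.coeff (k + 2)
      - ((k : ℂ) * (k - 1)) • Q.coeff k + ((k : ℂ) + 1) • (Q.coeff (k + 1) * matC L)
      - (k : ℂ) • (Q.coeff k * matU L) - Q.coeff k * matV L := by
  have e : derivative Q * (C (matC L) - X * C (matU L))
      = derivative Q * C (matC L) - derivative Q * X * C (matU L) := by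
    rw [mul_sub, mul_assoc]
  have e' : derivative (derivative Q) * (1 - X ^ 2)
      = derivative (derivative Q) - derivative (derivative Q) * X ^ 2 := by
    rw [mul_sub, mul_one]
  rw [opD_act, e, e', coeff_sub, coeff_add, coeff_sub, coeff_sub, coeff_mul_C, coeff_mul_C,
    coeff_mul_C, coeff_derivative_mul_X, coeff_derivative_derivative_mul_X_sq,
    coeff_derivative_smul, coeff_derivative_smul, coeff_derivative_smul, smul_smul,
    smul_mul_assoc, smul_mul_assoc]
  have h : ((k : ℂ) + 1) * (((k + 1 : ℕ) : ℂ) + 1) = (k + 1) * (k + 2) := by push_cast; ring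
  rw [h]
  abel

theorem coeff_opE_act (Q : MatPoly L) (k : ℕ) :
    ((opE L).act Q).coeff k = ((k : ℂ) + 1) • (Q.coeff (k + 1) * matB0 L)
      + (k : ℂ) • (Q.coeff k * matB1 L) + Q.coeff k * matA L := by
  have e : derivative Q * (C (matB0 L) + X * C (matB1 L))
      = derivative Q * C (matB0 L) + derivative Q * X * C (matB1 L) := by
    rw [mul_add, mul_assoc]
  rw [opE_act, e, coeff_add, coeff_add, coeff_mul_C, coeff_mul_C, coeff_mul_C,
    coeff_derivative_mul_X, coeff_derivative_smul, smul_mul_assoc, smul_mul_assoc]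

theorem eigD_eq_diagonal (n : ℕ) : eigD L n = Matrix.diagonal fun i : Fin (L + 1) =>
    -(n : ℂ) * (n - 1) - n * (L + 3) + i * (L - i) := by
  rw [← diagMat_eq (c := fun i => -(n : ℂ) * (n - 1) - n * (L + 3) + i * (L - i))]
  simp only [eigD, diagMat, two_mul_ell]

theorem eigD_eq (n : ℕ) :
    eigD L n = -(((n : ℂ) * (n - 1)) • (1 : Mat L)) - (n : ℂ) • matU L - matV L := by
  rw [eigD_eq_diagonal, matU_eq, matV_eq, diagMat_eq, diagMat_eq]
  ext i j
  rcases eq_or_ne i j with rfl | h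
  · simp
  · simp [h]

theorem eigE_eq (n : ℕ) : eigE L n = (n : ℂ) • matB1 L + matA L := by
  simp only [eigE, matB1, matA, Finset.smul_sum, ← Finset.sum_add_distrib, smul_smul, ← add_smul]
  refine Finset.sum_congr rfl fun i _ => ?_
  congr 1
  rw [neg_mul, div_neg]
  ring

theorem eigE_eq_diagonal (n : ℕ) : eigE L n = Matrix.diagonal fun i : Fin (L + 1) =>
    (n : ℂ) * (ell L - i) / (2 * ell L) - (2 * ell L + 2) * (i - 2 * ell L) / (4 * ell L) :=
  diagMat_eq (c := fun i => (n : ℂ) * (ell L - i) / (2 * ell L)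
    - (2 * ell L + 2) * (i - 2 * ell L) / (4 * ell L))

theorem eigD_mul_eigE (n : ℕ) : eigD L n * eigE L n = eigE L n * eigD L n := by
  rw [eigD_eq_diagonal, eigE_eq_diagonal, Matrix.diagonal_mul_diagonal,
    Matrix.diagonal_mul_diagonal]
  simp only [mul_comm]

theorem IsMonicOrthogonal.opD_act {P : ℕ → MatPoly L} (hP : IsMonicOrthogonal L P) (n : ℕ) :
    (opD L).act (P n) = C (eigD L n) * P n := by
  refine hP.act_eq (isSymmetric_opD L) (fun k Q hQ => ?_) n
  rw [coeff_opD_act, hQ (k + 2) (by omega), hQ (k + 1) (by omega), eigD_eq,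
    mul_sub (Q.coeff k), mul_sub (Q.coeff k), mul_neg, mul_smul_comm, mul_smul_comm,
    mul_one (Q.coeff k), zero_mul, smul_zero, smul_zero, zero_sub, add_zero]

theorem IsMonicOrthogonal.opE_act (hL : 0 < L) {P : ℕ → MatPoly L} (hP : IsMonicOrthogonal L P)
    (n : ℕ) : (opE L).act (P n) = C (eigE L n) * P n := by
  refine hP.act_eq (isSymmetric_opE hL) (fun k Q hQ => ?_) n
  rw [coeff_opE_act, hQ (k + 1) (by omega), eigE_eq, mul_add, mul_smul_comm, zero_mul, smul_zero,
    zero_add]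

/-- Both operators commute with left multiplication by constant matrices, so it suffices to compare
them on the orthogonal polynomials, where each composition multiplies by the product of two diagonal
eigenvalue matrices. -/
theorem opE_act_opD_act (hL : 0 < L) (Q : MatPoly L) :
    (opE L).act ((opD L).act Q) = (opD L).act ((opE L).act Q) := by
  have hP := isMonicOrthogonal_gramSchmidtMonic L
  refine induction_monic hP.1
    (motive := fun Q => (opE L).act ((opD L).act Q) = (opD L).act ((opE L).act Q))
    (by simp only [DiffOp.act_zero]) (fun Q R h1 h2 => by simp only [DiffOp.act_add, h1, h2])
    (N := Q.natDegree + 1) (fun A k _ => ?_)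
    (degree_le_natDegree.trans_lt (by exact_mod_cast Nat.lt_succ_self _))
  simp only [DiffOp.act_C_mul, hP.opD_act, hP.opE_act hL]
  rw [← mul_assoc (C (eigD L k)), ← mul_assoc (C (eigE L k)), ← C_mul, ← C_mul, eigD_mul_eigE]

end MVOP
end

theorem theorem3p1 (L : ℕ) :
    -- the monic matrix-valued orthogonal polynomials exist and are unique
    (∃! P : ℕ → MVOP.MatPoly L, MVOP.IsMonicOrthogonal L P) ∧
    -- they are eigenfunctions of the two operators
    (∀ P : ℕ → MVOP.MatPoly L, MVOP.IsMonicOrthogonal L P →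
      (∀ n, (MVOP.opD L).act (P n) = Polynomial.C (MVOP.eigD L n) * P n) ∧
      (0 < L → ∀ n, (MVOP.opE L).act (P n) = Polynomial.C (MVOP.eigE L n) * P n)) ∧
    -- the operators commute
    (0 < L → ∀ Q : MVOP.MatPoly L,
      (MVOP.opE L).act ((MVOP.opD L).act Q) = (MVOP.opD L).act ((MVOP.opE L).act Q)) ∧
    -- the operators are symmetric with respect to the weight
    (MVOP.opD L).IsSymmetric ∧
    (0 < L → (MVOP.opE L).IsSymmetric) :=
  ⟨⟨MVOP.gramSchmidtMonic L, MVOP.isMonicOrthogonal_gramSchmidtMonic L,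
      fun _ hP => hP.unique (MVOP.isMonicOrthogonal_gramSchmidtMonic L)⟩,
    fun _ hP => ⟨hP.opD_act, fun hL => hP.opE_act hL⟩,
    fun hL => MVOP.opE_act_opD_act hL,
    MVOP.isSymmetric_opD L,
    fun hL => MVOP.isSymmetric_opE hL⟩
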